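/- Let $d,m\ge 0$ be integers, $D=(\mathbb R/\mathbb Z)^d$, let $\|\cdot\|$ and $((\cdot,\cdot))$ be the norm and inner product of $L^2(D)$, let $\mathrm{Sol}(D)$ be the space of divergence-free vector fields of zero mean in $L^2(D,\mathbb R^d)$, and $\mathbb P$ the $L^2$-orthogonal projection onto $\mathrm{Sol}(D)$. Put $K[v]=\frac12\int_D|\nabla^m v|^2dx$, with $K[v]=+\infty$ if the weak derivative $\nabla^m v$ is not in $L^2$, and, for smooth $b$, $K'[b]=(-\Delta)^m b$ and $\eta_K[a,b]=K[a]-K[b]-((K'[b],a-b))$. For $T>0$, a dissipative solution on $[0,T]$ of the gradient-flow equation $$\partial_t\varphi+\nabla\cdot(\varphi v)=0,\qquad (-\Delta)^m v=-\mathbb P\nabla\cdot(\nabla\varphi\otimes\nabla\varphi)$$ is a pair $(B,v)$ with $B_t=\nabla\varphi_t$, $\varphi_t$ of zero mean, $B$ continuous from $[0,T]$ to $L^2(D,\mathbb R^d)$ with its weak topology, $v\in L^2([0,T],\mathrm{Sol}(D))$, such that $\partial_t\varphi+\nabla\cdot(\varphi v)=0$ in the weak sense, and such that, for all smooth $z:[0,T]\times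 D\to\mathbb R^d$ with $z_t\in\mathrm{Sol}(D)$, all constants $r\ge 0$ with $rI_d+\nabla z_t(x)+\nabla z_t(x)^T\ge 0$ for all $(t,x)$, and all $t\in[0,T]$, $$\int_0^t\big\{2K[v_s]+((B_s\otimes B_s,\,rI_d+\nabla z_s+\nabla z_s^T))-2K[z_s]\big\}e^{-sr}ds+\|B_t\|^2e^{-tr}\le\|B_0\|^2 .$$ Theorem. For $a,b\in\mathrm{Sol}(D)$ with $b$ smooth, $\eta_K[a,b]=\frac12\int_D|\nabla^m(a-b)|^2dx$. Moreover, for every $L\ge 0$ there is a constant $C\ge 0$, depending only on $d$, $m$ and $L$, with the following property. Let $T>0$, let $(B=\nabla\varphi,v)$ be a dissipative solution on $[0,T]$, and let $\beta=\nabla\psi$ and $\omega$ be smooth on $[0,T]\times D$, with $\omega_t\in\mathrm{Sol}(D)$ and with $\beta_t$ and $\omega_t$ $L$-Lipschitz in space for every $t\in[0,T]$. Set $$J_t^L=-((B_t-\beta_t,\nabla(\omega_t\cdot\beta_t)+\partial_t\beta_t))-((\mathbb P\nabla\cdot(\beta_t\otimes\beta_t)+K'[\omega_t],v_t-\omega_t)).$$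 Then $\eta_K[v_s,\omega_s]$ is finite for almost every $s\in[0,T]$, $s\mapsto\eta_K[v_s,\omega_s]$ and $s\mapsto J_s^L$ are integrable on $[0,T]$, and for all $t\in[0,T]$ $$\|B_t-\beta_t\|^2+\int_0^te^{(t-s)C}\big\{\eta_K[v_s,\omega_s]-2J_s^L\big\}ds\le\|B_0-\beta_0\|^2e^{tC}.$$ If in addition $(\beta,\omega)$ is a smooth solution of the gradient-flow equation, namely $\partial_t\beta_t+\nabla(\omega_t\cdot\beta_t)=0$ and $K'[\omega_t]=-\mathbb P\nabla\cdot(\beta_t\otimes\beta_t)$ on $[0,T]$, then $J_t^L=0$ for all $t\in[0,T]$, and $$\|B_t-\beta_t\|^2+\int_0^te^{(t-s)C}\eta_K[v_s,\omega_s]ds\le\|B_0-\beta_0\|^2e^{tC}\qquad(t\in[0,T]).$$ In particular, if moreover $B_0=\beta_0$, then $B_t=\beta_t$ for all $t\in[0,T]$ and $v_t=\omega_t$ for almost every $t\in[0,T]$. -/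

import Mathlib

open MeasureTheory Set
open scoped NNReal ENNReal

noncomputable section

namespace GFTorus

/-! Calculus on the torus `𝕋^d = (ℝ/ℤ)^d`, which is `UnitAddTorus (Fin d)` with its Haar
probability measure. -/

/-- The space `ℝ^d` with its Euclidean norm. -/
abbrev Vec (d : ℕ) : Type := EuclideanSpace ℝ (Fin d)

/-- The Hilbert space `L²(𝕋^d, ℝ)`. -/
abbrev L2Scalar (d : ℕ) : Type := Lp ℝ 2 (volume : Measure (UnitAddTorus (Fin d)))

/-- The Hilbert space `L²(𝕋^d, ℝ^d)`. -/
abbrev L2Field (d : ℕ) : Type := Lp (Vec d) 2 (volume : Measure (UnitAddTorus (Fin d)))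

/-- The covering map `ℝ^d → 𝕋^d`. -/
def proj {d : ℕ} (x : Vec d) : UnitAddTorus (Fin d) := fun i => (x i : UnitAddCircle)

section Calculus

open scoped ContDiff

variable {d : ℕ} {F : Type*} [NormedAddCommGroup F] [NormedSpace ℝ F]

/-- A function on the torus is smooth if its periodic lift to `ℝ^d` is. -/
def IsSmooth (f : UnitAddTorus (Fin d) → F) : Prop :=
  ContDiff ℝ ∞ (fun x : Vec d => f (proj x))

/-- Smoothness on `[0,T] × 𝕋^d`, jointly in time and space and up to the times `0` and `T`. -/
def IsSmoothOn (T : ℝ) (f : ℝ → UnitAddTorus (Fin d) → F) : Prop :=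
  ContDiffOn ℝ ∞ (fun p : ℝ × Vec d => f p.1 (proj p.2)) (Icc 0 T ×ˢ univ)

/-- The partial derivative `∂ᵢ f` on the torus. -/
def pderiv (i : Fin d) (f : UnitAddTorus (Fin d) → F) (x : UnitAddTorus (Fin d)) : F :=
  deriv (fun h : ℝ => f (x + Pi.single i (h : UnitAddCircle))) 0

/-- The iterated partial derivative `∂_{I 0} ⋯ ∂_{I (m-1)} f`. -/
def pderivs {m : ℕ} (I : Fin m → Fin d) (f : UnitAddTorus (Fin d) → F) :
    UnitAddTorus (Fin d) → F :=
  (List.ofFn I).foldr (fun i g => pderiv i g) f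

/-- The time derivative on `[0,T]` (one-sided at the end points). -/
def tderiv (T : ℝ) (f : ℝ → UnitAddTorus (Fin d) → F) (t : ℝ) (x : UnitAddTorus (Fin d)) : F :=
  derivWithin (fun s => f s x) (Icc 0 T) t

/-- The operator `(-Δ)^m`, applied componentwise. -/
def negLapPow (m : ℕ) (f : UnitAddTorus (Fin d) → F) : UnitAddTorus (Fin d) → F :=
  (fun (g : UnitAddTorus (Fin d) → F) (x : UnitAddTorus (Fin d)) =>
    -∑ i, pderiv i (pderiv i g) x)^[m] f

/-- The gradient of a scalar function. -/
def grad (f : UnitAddTorus (Fin d) → ℝ) (x : UnitAddTorus (Fin d)) : Vec d :=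
  WithLp.toLp 2 (fun i => pderiv i f x)

/-- The Jacobian matrix `(∂ⱼ zᵢ)ᵢⱼ` of a vector field. -/
def jac (z : UnitAddTorus (Fin d) → Vec d) (x : UnitAddTorus (Fin d)) :
    Matrix (Fin d) (Fin d) ℝ :=
  Matrix.of fun i j => pderiv j (fun y => z y i) x

/-- The field `∇·(b ⊗ b)`, with components `∑ⱼ ∂ⱼ (bᵢ bⱼ)`. -/
def divTensor (b : UnitAddTorus (Fin d) → Vec d) (x : UnitAddTorus (Fin d)) : Vec d :=
  WithLp.toLp 2 (fun i => ∑ j, pderiv j (fun y => b y i * b y j) x)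

/-- The class in `L²` of a vector field (used for smooth fields only; `0` for a field that is not
square integrable). -/
def toL2 (f : UnitAddTorus (Fin d) → Vec d) : L2Field d :=
  open Classical in
  if h : MemLp f 2 (volume : Measure (UnitAddTorus (Fin d))) then h.toLp f else 0

/-- `f` is `L`-Lipschitz in space, for the Euclidean distance. -/
def SpaceLipschitz (L : ℝ≥0) (f : UnitAddTorus (Fin d) → Vec d) : Prop :=
  LipschitzWith L (fun x : Vec d => f (proj x))

end Calculus

/-- `Sol(𝕋^d)`: the square integrable fields that are divergence free in the weak sense
(orthogonal to the gradients of smooth functions) and of zero mean (orthogonal to constants). -/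
def Sol (d : ℕ) : Submodule ℝ (L2Field d) :=
  (Submodule.span ℝ
    ({g : L2Field d | ∃ ζ : UnitAddTorus (Fin d) → ℝ, IsSmooth ζ ∧ g =ᵐ[volume] grad ζ} ∪
      {g : L2Field d | ∃ c : Vec d, g =ᵐ[volume] fun _ => c}))ᗮ

instance instHasProjSol (d : ℕ) : (Sol d).HasOrthogonalProjection := by
  have : CompleteSpace (Sol d) := (Submodule.isClosed_orthogonal _).completeSpace_coe
  exact Submodule.HasOrthogonalProjection.ofCompleteSpace _

/-- The `L²`-orthogonal projection `ℙ` onto `Sol(𝕋^d)`. -/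
def leray (d : ℕ) (g : L2Field d) : L2Field d :=
  (Sol d).starProjection g

/-- `B = ∇φ` in the weak sense. -/
def IsWeakGrad {d : ℕ} (φ : L2Scalar d) (B : L2Field d) : Prop :=
  ∀ ζ : UnitAddTorus (Fin d) → ℝ, IsSmooth ζ → ∀ i : Fin d,
    ∫ x, φ x * pderiv i ζ x = -∫ x, B x i * ζ x

/-- The family `W` is `∇^m v` in the weak sense: `W I = ∂_{I 0} ⋯ ∂_{I (m-1)} v`. -/
def IsWeakDerivs {d : ℕ} (m : ℕ) (v : L2Field d) (W : (Fin m → Fin d) → L2Field d) : Prop :=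
  ∀ I : Fin m → Fin d, ∀ ζ : UnitAddTorus (Fin d) → ℝ, IsSmooth ζ → ∀ j : Fin d,
    ∫ x, v x j * pderivs I ζ x = (-1) ^ m * ∫ x, W I x j * ζ x

/-- `K[v] = ½ ∫ |∇^m v|²`, which is `+∞` if the weak derivative `∇^m v` is not in `L²`
(the infimum runs over at most one family `W`). -/
def K {d : ℕ} (m : ℕ) (v : L2Field d) : ℝ≥0∞ :=
  ⨅ (W : (Fin m → Fin d) → L2Field d) (_ : IsWeakDerivs m v W),
    ENNReal.ofReal (1 / 2 * ∑ I, ‖W I‖ ^ 2)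

/-- `K'[ω] = (-Δ)^m ω`, for a smooth field `ω`. -/
def K' {d : ℕ} (m : ℕ) (ω : UnitAddTorus (Fin d) → Vec d) : L2Field d :=
  toL2 (negLapPow m ω)

/-- The relative entropy `η_K[a,b] = K[a] - K[b] - ((K'[b], a - b))`, for a smooth field `b`. -/
def relEntropy {d : ℕ} (m : ℕ) (a : L2Field d) (b : UnitAddTorus (Fin d) → Vec d) : EReal :=
  (K m a : EReal) - (K m (toL2 b) : EReal) - ((inner ℝ (K' m b) (a - toL2 b) : ℝ) : EReal)

/-- The matrix `r I + ∇z + ∇zᵀ`. -/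
def symMatrix {d : ℕ} (r : ℝ) (z : UnitAddTorus (Fin d) → Vec d) (x : UnitAddTorus (Fin d)) :
    Matrix (Fin d) (Fin d) ℝ :=
  r • (1 : Matrix (Fin d) (Fin d) ℝ) + jac z x + (jac z x).transpose

/-- `(B = ∇φ, v)` is a dissipative solution on `[0,T]` of
`∂ₜφ + ∇·(φ v) = 0`, `(-Δ)^m v = -ℙ ∇·(∇φ ⊗ ∇φ)`. -/
structure IsDissipativeSolution {d : ℕ} (m : ℕ) (T : ℝ) (φ : ℝ → L2Scalar d)
    (B v : ℝ → L2Field d) : Prop where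
  /-- `φ_t` has zero mean. -/
  mean_zero : ∀ t ∈ Icc 0 T, ∫ x, φ t x = 0
  /-- `B_t = ∇φ_t`. -/
  weak_grad : ∀ t ∈ Icc 0 T, IsWeakGrad (φ t) (B t)
  /-- `B` is continuous on `[0,T]` for the weak topology of `L²`. -/
  weak_cont : ∀ g : L2Field d, ContinuousOn (fun t => (inner ℝ g (B t) : ℝ)) (Icc 0 T)
  /-- `v` belongs to `L²([0,T], Sol)`. -/
  memLp : MemLp v 2 (volume.restrict (Icc 0 T))
  mem_sol : ∀ᵐ t ∂(volume.restrict (Icc 0 T)), v t ∈ Sol d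
  /-- The transport equation `∂ₜφ + ∇·(φ v) = 0`, in the weak sense on `[0,t]` for every `t`. -/
  transport : ∀ ζ : ℝ → UnitAddTorus (Fin d) → ℝ, IsSmoothOn T ζ → ∀ t ∈ Icc 0 T,
    (∫ x, φ t x * ζ t x) - ∫ x, φ 0 x * ζ 0 x =
      ∫ s in (0 : ℝ)..t, ∫ x, φ s x * (tderiv T ζ s x + inner ℝ (v s x) (grad (ζ s) x))
  /-- The exponentially weighted dissipation inequality, for all smooth `z` valued in `Sol` and all
  `r ≥ 0` with `r I + ∇z + ∇zᵀ ≥ 0`. All terms are nonnegative; `K[z]`, which is finite, stands on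
  the right-hand side. -/
  dissipation : ∀ z : ℝ → UnitAddTorus (Fin d) → Vec d, IsSmoothOn T z →
    (∀ t ∈ Icc 0 T, toL2 (z t) ∈ Sol d) →
    ∀ r : ℝ, 0 ≤ r → (∀ t ∈ Icc 0 T, ∀ x, (symMatrix r (z t) x).PosSemidef) →
    ∀ t ∈ Icc 0 T,
      (∫⁻ s in Icc 0 t,
          (2 * K m (v s) + ∫⁻ x, ENNReal.ofReal
            (∑ i, ∑ j, B s x i * B s x j * symMatrix r (z s) x i j)) *
          ENNReal.ofReal (Real.exp (-(s * r)))) +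
        ENNReal.ofReal (‖B t‖ ^ 2 * Real.exp (-(t * r))) ≤
      ENNReal.ofReal (‖B 0‖ ^ 2) +
        ∫⁻ s in Icc 0 t, 2 * K m (toL2 (z s)) * ENNReal.ofReal (Real.exp (-(s * r)))

/-- `J_t^L = -((B_t - β_t, ∇(ω_t·β_t) + ∂ₜβ_t)) - ((ℙ∇·(β_t ⊗ β_t) + K'[ω_t], v_t - ω_t))`. -/
def linTerm {d : ℕ} (m : ℕ) (T : ℝ) (B v : ℝ → L2Field d)
    (β ω : ℝ → UnitAddTorus (Fin d) → Vec d) (t : ℝ) : ℝ :=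
  -inner ℝ (B t - toL2 (β t))
      (toL2 fun x => grad (fun y => inner ℝ (ω t y) (β t y)) x + tderiv T β t x)
    - inner ℝ (leray d (toL2 (divTensor (β t))) + K' m (ω t)) (v t - toL2 (ω t))

/-- `(β, ω)` solves `∂ₜβ + ∇(ω·β) = 0`, `K'[ω] = -ℙ∇·(β ⊗ β)` on `[0,T]`. -/
def SolvesGF {d : ℕ} (m : ℕ) (T : ℝ) (β ω : ℝ → UnitAddTorus (Fin d) → Vec d) : Prop :=
  (∀ t ∈ Icc 0 T, ∀ x, tderiv T β t x + grad (fun y => inner ℝ (ω t y) (β t y)) x = 0) ∧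
  ∀ t ∈ Icc 0 T, K' m (ω t) = -leray d (toL2 (divTensor (β t)))

end GFTorus

end

open GFTorus

/-! The proof is a relative entropy argument in which no Gronwall lemma is needed, because the
exponential weight is already built into the dissipation inequality. Write `w = v - ω`, `D = B - β`,
and expand `‖D‖² = ‖B‖² - 2((B,β)) + ‖β‖²`, each term carrying the weight `e^{-tr}`. The first term
is controlled by the dissipation inequality with `z = ω` (`dissipation_real`). The second is given
by the transport equation tested with `e^{-sr} div β`, since `((∇φ,β)) = -∫ φ div β`
(`weighted_inner_evolution`). The third is classical calculus (`weighted_norm_sq_evolution`).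

It remains to compare integrands at a fixed time (`relative_entropy_estimate`). Because `K` is a
quadratic form, `K[v] - K[ω] - ((K'[ω],w))` is exactly `K[w]`, so the integrand contains `2 K[w]`
while only one `K[w]` is to be kept. The cubic terms collapse, by `relative_energy_identity`, to
`((∇ω D, D)) + ((div β D, w))`. Three cancellations make this work: `∇β` is a symmetric matrix
because `β` is a gradient; `(∇β)β = ½∇|β|²` is orthogonal to divergence-free fields; and the
divergence of the antisymmetric tensor `β ⊗ ω - ω ⊗ β` is orthogonal to the gradient `B`.

The first remaining term is at least `-L‖D‖²`. The second is at least `-dL‖D‖‖w‖`, and Young's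
inequality with the Poincaré inequality `‖w‖² ≤ 2 K[w]` (`norm_sq_le_two_mul_K`) absorbs it into the
spare `K[w]`. This gives `C = 2L + 2(dL)²`. Since `C ≥ 2L`, the choice `r = C` is admissible in the
dissipation inequality, and the two roles of the constant coincide.

The analytic facts about rough fields (uniqueness of weak derivatives, Poincaré, integration by
parts of `φ v·∇ζ` with `v` only in `L²`) are obtained from Fourier series on the torus.
Measurability in time rests on the Lusin–Souslin theorem. -/

noncomputable section

namespace GFTorus

/-! ### Differential calculus on the torus through periodic lifts. -/

section Smooth

open scoped ContDiff

variable {d : ℕ} {F G H : Type*} [NormedAddCommGroup F] [NormedSpace ℝ F]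
  [NormedAddCommGroup G] [NormedSpace ℝ G] [NormedAddCommGroup H] [NormedSpace ℝ H]

/-- Openness, and not only the quotient property, is what survives products; this allows continuity
on `[0,T] × 𝕋^d` to be checked on `[0,T] × ℝ^d`. -/
theorem isOpenQuotientMap_proj : IsOpenQuotientMap (proj : Vec d → UnitAddTorus (Fin d)) :=
  (IsOpenQuotientMap.piMap fun _ : Fin d =>
    (QuotientAddGroup.isOpenQuotientMap_mk :
      IsOpenQuotientMap (QuotientAddGroup.mk : ℝ → UnitAddCircle))).comp
    (EuclideanSpace.equiv (Fin d) ℝ).toHomeomorph.isOpenQuotientMap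

theorem proj_add_smul_single (x : Vec d) (i : Fin d) (h : ℝ) :
    proj (x + h • EuclideanSpace.single i (1 : ℝ)) =
      proj x + Pi.single i (h : UnitAddCircle) := by
  funext j
  by_cases hj : j = i
  · subst hj; simp [proj]
  · simp [proj, hj]

theorem IsSmooth.continuous {f : UnitAddTorus (Fin d) → F} (hf : IsSmooth f) : Continuous f :=
  isOpenQuotientMap_proj.continuous_comp_iff.1 (ContDiff.continuous hf)

theorem pderiv_proj_eq_lineDeriv (i : Fin d) (f : UnitAddTorus (Fin d) → F) (x : Vec d) :
    pderiv i f (proj x) =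
      lineDeriv ℝ (fun y : Vec d => f (proj y)) x (EuclideanSpace.single i 1) := by
  simp only [pderiv, lineDeriv, proj_add_smul_single]

theorem IsSmooth.pderiv_proj {f : UnitAddTorus (Fin d) → F} (hf : IsSmooth f) (i : Fin d)
    (x : Vec d) : pderiv i f (proj x) =
      fderiv ℝ (fun y : Vec d => f (proj y)) x (EuclideanSpace.single i 1) := by
  rw [pderiv_proj_eq_lineDeriv]
  exact (ContDiff.differentiable hf (by simp)).differentiableAt.lineDeriv_eq_fderiv

theorem IsSmooth.pderiv {f : UnitAddTorus (Fin d) → F} (hf : IsSmooth f) (i : Fin d) :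
    IsSmooth (pderiv i f) := by
  have : (fun x : Vec d => GFTorus.pderiv i f (proj x)) =
      fun x => fderiv ℝ (fun y : Vec d => f (proj y)) x (EuclideanSpace.single i 1) :=
    funext (hf.pderiv_proj i)
  unfold IsSmooth
  rw [this]
  exact (ContDiff.fderiv_right (m := ∞) hf (by simp)).clm_apply contDiff_const

theorem IsSmooth.hasDerivAt {f : UnitAddTorus (Fin d) → F} (hf : IsSmooth f) (i : Fin d)
    (x : UnitAddTorus (Fin d)) :
    HasDerivAt (fun h : ℝ => f (x + Pi.single i (h : UnitAddCircle))) (GFTorus.pderiv i f x) 0 := by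
  obtain ⟨y, rfl⟩ := isOpenQuotientMap_proj.surjective x
  apply DifferentiableAt.hasDerivAt
  simp_rw [← proj_add_smul_single]
  have h1 := (ContDiff.differentiable hf (by simp))
  have : DifferentiableAt ℝ (fun h : ℝ => y + h • (EuclideanSpace.single i (1 : ℝ) : Vec d)) 0 := by
    fun_prop
  exact DifferentiableAt.comp (g := fun z : Vec d => f (proj z)) (0 : ℝ) (h1 _) this

theorem IsSmooth.hasDerivAt_shift {f : UnitAddTorus (Fin d) → F} (hf : IsSmooth f) (i : Fin d)
    (x : UnitAddTorus (Fin d)) (t : ℝ) :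
    HasDerivAt (fun h : ℝ => f (x + Pi.single i (h : UnitAddCircle)))
      (GFTorus.pderiv i f (x + Pi.single i (t : UnitAddCircle))) t := by
  have h := hf.hasDerivAt i (x + Pi.single i (t : UnitAddCircle))
  have h2 : HasDerivAt (fun s : ℝ => s - t) 1 t := (hasDerivAt_id t).sub_const t
  have h3 : HasDerivAt (fun h : ℝ => f (x + Pi.single i (t : UnitAddCircle) +
      Pi.single i (h : UnitAddCircle)))
      (GFTorus.pderiv i f (x + Pi.single i (t : UnitAddCircle))) (t - t) := by simpa using h
  have h4 := HasDerivAt.scomp (h := fun s : ℝ => s - t) t h3 h2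
  simp only [one_smul, Function.comp_def, add_assoc, ← Pi.single_add, ← AddCircle.coe_add] at h4
  simpa using h4

theorem pderiv_eq_of_hasDerivAt {f : UnitAddTorus (Fin d) → F} {i : Fin d}
    {x : UnitAddTorus (Fin d)} {f' : F}
    (h : HasDerivAt (fun h : ℝ => f (x + Pi.single i (h : UnitAddCircle))) f' 0) :
    pderiv i f x = f' := h.deriv

theorem IsSmooth.const (c : F) : IsSmooth (fun _ : UnitAddTorus (Fin d) => c) := contDiff_const

theorem IsSmooth.add {f g : UnitAddTorus (Fin d) → F} (hf : IsSmooth f) (hg : IsSmooth g) :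
    IsSmooth (fun x => f x + g x) := ContDiff.add hf hg

theorem IsSmooth.sub {f g : UnitAddTorus (Fin d) → F} (hf : IsSmooth f) (hg : IsSmooth g) :
    IsSmooth (fun x => f x - g x) := ContDiff.sub hf hg

theorem IsSmooth.neg {f : UnitAddTorus (Fin d) → F} (hf : IsSmooth f) :
    IsSmooth (fun x => -f x) := ContDiff.neg hf

theorem IsSmooth.mul {A : Type*} [NormedRing A] [NormedAlgebra ℝ A]
    {f g : UnitAddTorus (Fin d) → A} (hf : IsSmooth f) (hg : IsSmooth g) :
    IsSmooth (fun x => f x * g x) := ContDiff.mul hf hg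

theorem IsSmooth.sum {ι : Type*} {s : Finset ι} {f : ι → UnitAddTorus (Fin d) → F}
    (hf : ∀ i ∈ s, IsSmooth (f i)) : IsSmooth (fun x => ∑ i ∈ s, f i x) :=
  ContDiff.sum (f := fun i (x : Vec d) => f i (proj x)) hf

theorem IsSmooth.clm (A : F →L[ℝ] G) {f : UnitAddTorus (Fin d) → F} (hf : IsSmooth f) :
    IsSmooth (fun x => A (f x)) := A.contDiff.comp hf

theorem IsSmooth.bilin (A : F →L[ℝ] G →L[ℝ] H) {f : UnitAddTorus (Fin d) → F}
    {g : UnitAddTorus (Fin d) → G} (hf : IsSmooth f) (hg : IsSmooth g) :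
    IsSmooth (fun x => A (f x) (g x)) := (A.contDiff.comp hf).clm_apply hg

theorem IsSmooth.inner {f g : UnitAddTorus (Fin d) → Vec d} (hf : IsSmooth f) (hg : IsSmooth g) :
    IsSmooth (fun x => (inner ℝ (f x) (g x) : ℝ)) := ContDiff.inner ℝ hf hg

theorem IsSmooth.coord {f : UnitAddTorus (Fin d) → Vec d} (hf : IsSmooth f) (i : Fin d) :
    IsSmooth (fun x => f x i) := hf.clm (EuclideanSpace.proj i)

theorem isSmooth_vec {f : UnitAddTorus (Fin d) → Vec d} (hf : ∀ i, IsSmooth (fun x => f x i)) :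
    IsSmooth f := contDiff_euclidean.2 hf

theorem IsSmooth.grad {f : UnitAddTorus (Fin d) → ℝ} (hf : IsSmooth f) : IsSmooth (grad f) :=
  isSmooth_vec fun i => hf.pderiv i

theorem pderiv_add {f g : UnitAddTorus (Fin d) → F} (hf : IsSmooth f) (hg : IsSmooth g)
    (i : Fin d) (x : UnitAddTorus (Fin d)) :
    pderiv i (fun y => f y + g y) x = pderiv i f x + pderiv i g x :=
  pderiv_eq_of_hasDerivAt ((hf.hasDerivAt i x).add (hg.hasDerivAt i x))

theorem pderiv_neg {f : UnitAddTorus (Fin d) → F} (hf : IsSmooth f)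
    (i : Fin d) (x : UnitAddTorus (Fin d)) :
    pderiv i (fun y => -f y) x = -pderiv i f x :=
  pderiv_eq_of_hasDerivAt (hf.hasDerivAt i x).neg

theorem pderiv_mul {A : Type*} [NormedRing A] [NormedAlgebra ℝ A]
    {f g : UnitAddTorus (Fin d) → A} (hf : IsSmooth f) (hg : IsSmooth g)
    (i : Fin d) (x : UnitAddTorus (Fin d)) :
    pderiv i (fun y => f y * g y) x = pderiv i f x * g x + f x * pderiv i g x := by
  have h := (hf.hasDerivAt i x).mul (hg.hasDerivAt i x)
  simp only [AddCircle.coe_zero, Pi.single_zero, add_zero] at h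
  exact pderiv_eq_of_hasDerivAt h

theorem pderiv_clm (A : F →L[ℝ] G) {f : UnitAddTorus (Fin d) → F} (hf : IsSmooth f)
    (i : Fin d) (x : UnitAddTorus (Fin d)) :
    pderiv i (fun y => A (f y)) x = A (pderiv i f x) :=
  pderiv_eq_of_hasDerivAt (A.hasFDerivAt.comp_hasDerivAt (0 : ℝ) (hf.hasDerivAt i x))

theorem pderiv_sum {ι : Type*} {s : Finset ι} {f : ι → UnitAddTorus (Fin d) → F}
    (hf : ∀ i ∈ s, IsSmooth (f i)) (j : Fin d) (x : UnitAddTorus (Fin d)) :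
    pderiv j (fun y => ∑ i ∈ s, f i y) x = ∑ i ∈ s, pderiv j (f i) x :=
  pderiv_eq_of_hasDerivAt (HasDerivAt.fun_sum fun i hi => (hf i hi).hasDerivAt j x)

theorem pderiv_coord {f : UnitAddTorus (Fin d) → Vec d} (hf : IsSmooth f) (i j : Fin d)
    (x : UnitAddTorus (Fin d)) : pderiv j (fun y => f y i) x = pderiv j f x i :=
  pderiv_clm (EuclideanSpace.proj i) hf j x

theorem pderiv_comm {f : UnitAddTorus (Fin d) → F} (hf : IsSmooth f) (i j : Fin d) :
    pderiv i (pderiv j f) = pderiv j (pderiv i f) := by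
  funext x
  obtain ⟨y, rfl⟩ := isOpenQuotientMap_proj.surjective x
  have hd : ContDiff ℝ ∞ (fun x : Vec d => f (proj x)) := hf
  have hdd : DifferentiableAt ℝ (fderiv ℝ (fun x : Vec d => f (proj x))) y :=
    ((hd.fderiv_right (m := ∞) (by simp)).differentiable (by simp)) y
  have key : ∀ k l : Fin d, pderiv k (pderiv l f) (proj y) =
      fderiv ℝ (fderiv ℝ (fun x : Vec d => f (proj x))) y (EuclideanSpace.single k 1)
        (EuclideanSpace.single l 1) := by
    intro k l
    rw [(hf.pderiv l).pderiv_proj]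
    simp_rw [hf.pderiv_proj l]
    rw [fderiv_clm_apply hdd (by fun_prop)]
    simp
  rw [key, key]
  exact (hd.contDiffAt.isSymmSndFDerivAt
    (by simpa using (WithTop.coe_le_coe.2 (le_top : (2 : ℕ∞) ≤ ⊤)))) _ _

theorem integrable_of_continuous {E : Type*} [NormedAddCommGroup E]
    {f : UnitAddTorus (Fin d) → E} (hf : Continuous f) :
    Integrable f := by
  obtain ⟨C, hC⟩ := (isCompact_range hf).isBounded.exists_norm_le
  exact Integrable.of_bound (hf.aestronglyMeasurable) C (.of_forall fun x => hC _ ⟨x, rfl⟩)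

/-- The integral of `f(x + h eᵢ)` does not depend on `h` by translation invariance; differentiating
under the integral sign at `h = 0` gives the claim. -/
theorem integral_pderiv {f : UnitAddTorus (Fin d) → ℝ} (hf : IsSmooth f) (i : Fin d) :
    ∫ x, pderiv i f x = 0 := by
  obtain ⟨C, hC⟩ := (isCompact_range (hf.pderiv i).continuous).isBounded.exists_norm_le
  have key := hasDerivAt_integral_of_dominated_loc_of_deriv_le (μ := volume) (𝕜 := ℝ)
    (F := fun h x => f (x + Pi.single i (h : UnitAddCircle))) (x₀ := 0) (s := univ)
    (bound := fun _ => C) (F' := fun h x => pderiv i f (x + Pi.single i (h : UnitAddCircle)))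
    Filter.univ_mem
    (.of_forall fun h => (hf.continuous.comp (by fun_prop)).aestronglyMeasurable)
    (integrable_of_continuous (hf.continuous.comp (by fun_prop)))
    ((hf.pderiv i).continuous.comp (by fun_prop)).aestronglyMeasurable
    (.of_forall fun x h _ => hC _ ⟨_, rfl⟩) (integrable_const _)
    (.of_forall fun x h _ => hf.hasDerivAt_shift i x h)
  have h2 := key.2
  have h3 : ∀ n : ℝ, ∫ a : UnitAddTorus (Fin d), f (a + Pi.single i (n : UnitAddCircle)) = ∫ a, f a := fun n =>
    integral_add_right_eq_self (μ := (volume : Measure (UnitAddTorus (Fin d)))) f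
      (Pi.single i (n : UnitAddCircle))
  simp only [h3] at h2
  simpa using h2.unique (hasDerivAt_const _ _)

theorem integral_mul_pderiv {f g : UnitAddTorus (Fin d) → ℝ} (hf : IsSmooth f) (hg : IsSmooth g)
    (i : Fin d) : ∫ x, f x * pderiv i g x = -∫ x, pderiv i f x * g x := by
  have h := integral_pderiv (hf.mul hg) i
  simp_rw [pderiv_mul hf hg] at h
  rw [integral_add] at h
  · linarith
  · exact integrable_of_continuous ((hf.pderiv i).mul hg).continuous
  · exact integrable_of_continuous (hf.mul (hg.pderiv i)).continuous

end Smooth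

/-! ### Fourier series, Parseval, and weak identities for `L²` fields. -/

section Fourier

open UnitAddTorus ComplexConjugate

variable {d : ℕ}

theorem volume_torus_eq_pi_haar :
    (volume : Measure (UnitAddTorus (Fin d))) =
      Measure.pi fun _ => AddCircle.haarAddCircle (T := (1 : ℝ)) := by
  have h : (volume : Measure UnitAddCircle) = AddCircle.haarAddCircle := by
    rw [AddCircle.volume_eq_smul_haarAddCircle]; simp
  rw [volume_pi, h]

/-- The Fourier coefficient of a real function, tested against `mFourier n`. -/
def fcoeff (f : UnitAddTorus (Fin d) → ℝ) (n : Fin d → ℤ) : ℂ :=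
  ∫ x, (f x : ℂ) * mFourier n x

/-- For real `f`, `fcoeff f n` is the complex conjugate of the usual Fourier coefficient, so this is
Parseval's identity in a form suited to weak derivatives, where characters play the role of test
functions. -/
theorem hasSum_fcoeff_mul_conj {f g : UnitAddTorus (Fin d) → ℝ} (hf : MemLp f 2)
    (hg : MemLp g 2) :
    HasSum (fun n => fcoeff f n * conj (fcoeff g n)) ((∫ x, f x * g x : ℝ) : ℂ) := by
  unfold fcoeff
  rw [volume_torus_eq_pi_haar] at hf hg ⊢
  have key := hasSum_prod_mFourierCoeff (d := Fin d) hf.ofReal.toLp hg.ofReal.toLp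
  have hf' := hf.ofReal (K := ℂ).coeFn_toLp
  have hg' := hg.ofReal (K := ℂ).coeFn_toLp
  convert! key using 1
  · funext n
    congr 1
    · rw [mFourierCoeff, ← integral_conj]
      refine integral_congr_ae ?_
      filter_upwards [hf'] with x hx
      simp only [hx, smul_eq_mul, map_mul, mFourier_neg, Complex.conj_conj]
      simp [mul_comm]
    · rw [mFourierCoeff, ← integral_conj]
      refine integral_congr_ae ?_
      filter_upwards [hg'] with x hx
      simp only [hx, smul_eq_mul, map_mul, mFourier_neg]
      simp [mul_comm]
  · rw [← integral_complex_ofReal]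
    refine integral_congr_ae ?_
    filter_upwards [hf', hg'] with x hx hx'
    simp only [hx, hx']
    simp

theorem hasSum_norm_fcoeff_sq {f : UnitAddTorus (Fin d) → ℝ} (hf : MemLp f 2) :
    HasSum (fun n => ‖fcoeff f n‖ ^ 2) (∫ x, f x ^ 2) := by
  have h := hasSum_fcoeff_mul_conj hf hf
  simp only [Complex.mul_conj, Complex.normSq_eq_norm_sq] at h
  simpa [sq] using Complex.hasSum_ofReal.1 h

theorem mFourier_add_single (n : Fin d → ℤ) (x : UnitAddTorus (Fin d)) (i : Fin d)
    (h : UnitAddCircle) :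
    mFourier n (x + Pi.single i h) = mFourier n x * fourier (n i) h := by
  have h1 : ∀ y z : UnitAddTorus (Fin d), mFourier n (y + z) = mFourier n y * mFourier n z := by
    intro y z
    simp [mFourier, Finset.prod_mul_distrib, fourier_apply, AddCircle.toCircle_add]
  rw [h1]
  congr 1
  simp only [mFourier, ContinuousMap.coe_mk]
  rw [Finset.prod_eq_single i]
  · simp
  · intro j _ hj
    simp [hj]
  · simp

theorem isSmooth_mFourier (n : Fin d → ℤ) : IsSmooth (mFourier n : UnitAddTorus (Fin d) → ℂ) := by
  unfold IsSmooth
  simp only [mFourier, ContinuousMap.coe_mk, proj, fourier_coe_apply]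
  refine contDiff_prod fun i _ => ?_
  refine ContDiff.cexp ?_
  refine ContDiff.div_const (ContDiff.mul contDiff_const ?_) _
  exact Complex.ofRealCLM.contDiff.comp (EuclideanSpace.proj (𝕜 := ℝ) i).contDiff

theorem pderiv_mFourier (n : Fin d → ℤ) (i : Fin d) (x : UnitAddTorus (Fin d)) :
    pderiv i (mFourier n) x = 2 * Real.pi * Complex.I * n i * mFourier n x := by
  refine pderiv_eq_of_hasDerivAt ?_
  simp_rw [mFourier_add_single]
  have h := (hasDerivAt_fourier 1 (n i) 0).const_mul (mFourier n x)
  convert! h using 1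
  simp
  ring

theorem MemLp.mul_continuous {𝕜 : Type*} [NormedRing 𝕜] {p : ℝ≥0∞}
    {f g : UnitAddTorus (Fin d) → 𝕜}
    (hf : MemLp f p) (hg : Continuous g) : MemLp (fun x => f x * g x) p := by
  obtain ⟨C, hC⟩ := (isCompact_range hg).isBounded.exists_norm_le
  exact MemLp.mul (memLp_top_of_bound hg.aestronglyMeasurable C
    (.of_forall fun x => hC _ ⟨x, rfl⟩)) hf

theorem memLp_coord (v : L2Field d) (j : Fin d) : MemLp (fun x => v x j) 2 :=
  (Lp.memLp v).eval_piLp j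

theorem integral_ofReal_mul {f : UnitAddTorus (Fin d) → ℝ} (hf : MemLp f 2)
    {z : UnitAddTorus (Fin d) → ℂ} (hz : Continuous z) :
    ∫ x, (f x : ℂ) * z x = (∫ x, f x * (z x).re : ℝ) + (∫ x, f x * (z x).im : ℝ) * Complex.I := by
  have h : Integrable fun x => (f x : ℂ) * z x :=
    (MemLp.mul_continuous hf.ofReal hz).integrable (by norm_num)
  rw [← integral_re_add_im h]
  simp

/-- The weak formulations only allow real test functions; splitting into real and imaginary parts
makes the characters admissible. -/
theorem isWeakGrad_complex {φ : L2Scalar d} {B : L2Field d} (h : IsWeakGrad φ B) (i : Fin d)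
    {ζ : UnitAddTorus (Fin d) → ℂ} (hζ : IsSmooth ζ) :
    ∫ x, (φ x : ℂ) * pderiv i ζ x = -∫ x, (B x i : ℂ) * ζ x := by
  rw [integral_ofReal_mul (Lp.memLp φ) (hζ.pderiv i).continuous,
    integral_ofReal_mul (memLp_coord B i) hζ.continuous]
  have h1 := h _ (hζ.clm Complex.reCLM) i
  have h2 := h _ (hζ.clm Complex.imCLM) i
  simp only [pderiv_clm _ hζ] at h1 h2
  simp only [Complex.reCLM_apply, Complex.imCLM_apply] at h1 h2
  rw [h1, h2]
  push_cast
  ring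

theorem ae_eq_zero_of_integral_mul_eq_zero {f : UnitAddTorus (Fin d) → ℝ} (hf : MemLp f 2)
    (h : ∀ ζ : UnitAddTorus (Fin d) → ℝ, IsSmooth ζ → ∫ x, f x * ζ x = 0) : f =ᵐ[volume] 0 := by
  have h0 : ∀ n, fcoeff f n = 0 := by
    intro n
    rw [fcoeff, integral_ofReal_mul hf (mFourier n).continuous]
    have h1 := h _ ((isSmooth_mFourier n).clm Complex.reCLM)
    have h2 := h _ ((isSmooth_mFourier n).clm Complex.imCLM)
    simp only [Complex.reCLM_apply, Complex.imCLM_apply] at h1 h2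
    simp [h1, h2]
  have h1 := hasSum_norm_fcoeff_sq hf
  simp only [h0, norm_zero, ne_eq, OfNat.ofNat_ne_zero, not_false_eq_true, zero_pow] at h1
  have h2 := h1.unique hasSum_zero
  rw [integral_eq_zero_iff_of_nonneg (fun x => sq_nonneg _) hf.integrable_sq] at h2
  filter_upwards [h2] with x hx
  simpa using hx

theorem mem_sol_iff {v : L2Field d} : v ∈ Sol d ↔
    (∀ ζ : UnitAddTorus (Fin d) → ℝ, IsSmooth ζ → ∫ x, (inner ℝ (v x) (grad ζ x) : ℝ) = 0) ∧
      ∀ c : Vec d, ∫ x, (inner ℝ (v x) c : ℝ) = 0 := by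
  have aux : ∀ (g : L2Field d) (f : UnitAddTorus (Fin d) → Vec d), g =ᵐ[volume] f →
      inner ℝ g v = ∫ x, (inner ℝ (v x) (f x) : ℝ) := by
    intro g f hg
    rw [L2.inner_def]
    refine integral_congr_ae ?_
    filter_upwards [hg] with x hx
    rw [hx, real_inner_comm]
  have memc : ∀ f : UnitAddTorus (Fin d) → Vec d, Continuous f → MemLp f 2 := by
    intro f hf
    obtain ⟨C, hC⟩ := (isCompact_range hf).isBounded.exists_norm_le
    exact MemLp.of_bound hf.aestronglyMeasurable C (.of_forall fun x => hC _ ⟨x, rfl⟩)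
  rw [Sol, Submodule.mem_orthogonal]
  constructor
  · intro h
    constructor
    · intro ζ hζ
      have hm := memc _ hζ.grad.continuous
      rw [← aux _ _ hm.coeFn_toLp]
      exact h _ (Submodule.subset_span (Or.inl ⟨ζ, hζ, hm.coeFn_toLp⟩))
    · intro c
      have hm := memc (fun _ => c) continuous_const
      rw [← aux _ _ hm.coeFn_toLp]
      exact h _ (Submodule.subset_span (Or.inr ⟨c, hm.coeFn_toLp⟩))
  · rintro ⟨h1, h2⟩ u hu
    induction hu using Submodule.span_induction with
    | mem g hg =>
      rcases hg with ⟨ζ, hζ, hg⟩ | ⟨c, hg⟩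
      · rw [aux _ _ hg, h1 ζ hζ]
      · rw [aux _ _ hg, h2 c]
    | zero => simp
    | add a b _ _ ha hb => rw [inner_add_left, ha, hb, add_zero]
    | smul r a _ ha => rw [inner_smul_left, ha, mul_zero]

theorem inner_vec_eq_sum (a b : Vec d) : (inner ℝ a b : ℝ) = ∑ i, a i * b i := by
  simp [PiLp.inner_apply, mul_comm]

theorem sol_sum_integral_pderiv {v : L2Field d} (hv : v ∈ Sol d)
    {ζ : UnitAddTorus (Fin d) → ℝ} (hζ : IsSmooth ζ) :
    ∑ j, ∫ x, v x j * pderiv j ζ x = 0 := by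
  rw [← integral_finsetSum]
  · simpa [inner_vec_eq_sum, grad] using (mem_sol_iff.1 hv).1 ζ hζ
  · intro j _
    exact (MemLp.mul_continuous (memLp_coord v j) (hζ.pderiv j).continuous).integrable
      (by norm_num)

theorem sol_sum_integral_pderiv_complex {v : L2Field d} (hv : v ∈ Sol d)
    {ζ : UnitAddTorus (Fin d) → ℂ} (hζ : IsSmooth ζ) :
    ∑ j, ∫ x, (v x j : ℂ) * pderiv j ζ x = 0 := by
  have h1 := sol_sum_integral_pderiv hv (hζ.clm Complex.reCLM)
  have h2 := sol_sum_integral_pderiv hv (hζ.clm Complex.imCLM)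
  simp only [pderiv_clm _ hζ] at h1 h2
  simp only [Complex.reCLM_apply, Complex.imCLM_apply] at h1 h2
  simp_rw [fun j => integral_ofReal_mul (memLp_coord v j) (hζ.pderiv j).continuous]
  rw [Finset.sum_add_distrib, ← Finset.sum_mul, ← Complex.ofReal_sum, ← Complex.ofReal_sum, h1, h2]
  simp

/-- For divergence free `v ∈ L²` and `φ ∈ H¹`, `∫ φ v·∇ζ = -∫ ζ v·∇φ`. -/
theorem integral_mul_inner_grad_of_mem_sol {φ : L2Scalar d} {B v : L2Field d}
    (hB : IsWeakGrad φ B) (hv : v ∈ Sol d) {ζ : UnitAddTorus (Fin d) → ℝ} (hζ : IsSmooth ζ) :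
    ∫ x, φ x * (inner ℝ (v x) (grad ζ x) : ℝ) = -∫ x, ζ x * (inner ℝ (v x) (B x) : ℝ) := by
  have m0 : ∀ j, MemLp (fun x => v x j * pderiv j ζ x) 2 := fun j =>
    MemLp.mul_continuous (memLp_coord v j) (hζ.pderiv j).continuous
  have m1 : ∀ j, MemLp (fun x => v x j * ζ x) 2 := fun j =>
    MemLp.mul_continuous (memLp_coord v j) hζ.continuous
  -- All products are taken on the Fourier side, so that only `φ`, `Bⱼ`, `vⱼ ζ`, `vⱼ ∂ⱼζ` in `L²` is
  -- needed. Testing `B = ∇φ` with a character gives the coefficients of `Bⱼ`.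
  have hgrad : ∀ j n, fcoeff (fun x => B x j) n =
      -(2 * Real.pi * Complex.I * n j) * fcoeff φ n := by
    intro j n
    have h := isWeakGrad_complex hB j (isSmooth_mFourier n)
    simp only [pderiv_mFourier] at h
    unfold fcoeff
    rw [eq_neg_iff_add_eq_zero.1 h |> eq_neg_of_add_eq_zero_right, neg_mul, ← integral_const_mul]
    congr 2
    funext x
    ring
  -- The condition `div v = 0` is tested with `ζ` times a character; the two terms come from the
  -- product rule.
  have hdiv : ∀ n : Fin d → ℤ, ∑ j, (fcoeff (fun x => v x j * pderiv j ζ x) n +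
      2 * Real.pi * Complex.I * n j * fcoeff (fun x => v x j * ζ x) n) = 0 := by
    intro n
    have hs : IsSmooth (fun x => (ζ x : ℂ)) := hζ.clm Complex.ofRealCLM
    have h := sol_sum_integral_pderiv_complex hv (hs.mul (isSmooth_mFourier n))
    rw [← h]
    refine Finset.sum_congr rfl fun j _ => ?_
    simp only [pderiv_mul hs (isSmooth_mFourier n), pderiv_mFourier]
    have : ∀ x, pderiv j (fun y => (ζ y : ℂ)) x = ((pderiv j ζ x : ℝ) : ℂ) := fun x =>
      pderiv_clm Complex.ofRealCLM hζ j x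
    simp only [this, fcoeff]
    rw [← integral_const_mul, ← integral_add]
    · congr 1; funext x; push_cast; ring
    · exact (MemLp.mul_continuous (m0 j).ofReal (mFourier n).continuous).integrable (by norm_num)
    · exact ((MemLp.mul_continuous (m1 j).ofReal (mFourier n).continuous).integrable
        (by norm_num)).const_mul _
  have hsum : HasSum (fun n => ∑ j, (fcoeff φ n * conj (fcoeff (fun x => v x j * pderiv j ζ x) n) +
      fcoeff (fun x => B x j) n * conj (fcoeff (fun x => v x j * ζ x) n)))
      (∑ j, (((∫ x, φ x * (v x j * pderiv j ζ x) : ℝ) : ℂ) +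
        ((∫ x, B x j * (v x j * ζ x) : ℝ) : ℂ))) :=
    hasSum_sum fun j _ => (hasSum_fcoeff_mul_conj (Lp.memLp φ) (m0 j)).add
      (hasSum_fcoeff_mul_conj (memLp_coord B j) (m1 j))
  -- Mode by mode the Parseval sum vanishes: it is the coefficient of `φ` times the conjugate of
  -- `hdiv`, the sign in `hgrad` matching the conjugation of `2πi nⱼ`.
  have hzero : (fun n => ∑ j, (fcoeff φ n * conj (fcoeff (fun x => v x j * pderiv j ζ x) n) +
      fcoeff (fun x => B x j) n * conj (fcoeff (fun x => v x j * ζ x) n))) = fun _ => 0 := by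
    funext n
    have h := congrArg (fun z => fcoeff φ n * conj z) (hdiv n)
    simp only [map_sum, map_zero, mul_zero, Finset.mul_sum] at h
    rw [← h]
    refine Finset.sum_congr rfl fun j _ => ?_
    rw [hgrad]
    simp only [map_add, map_mul, Complex.conj_ofReal, Complex.conj_I, map_intCast, map_ofNat]
    ring
  rw [hzero] at hsum
  have h0 := hsum.unique hasSum_zero
  norm_cast at h0
  have e1 : ∫ x, φ x * (inner ℝ (v x) (grad ζ x) : ℝ) =
      ∑ j, ∫ x, φ x * (v x j * pderiv j ζ x) := by
    rw [← integral_finsetSum]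
    · simp [inner_vec_eq_sum, grad, Finset.mul_sum]
    · exact fun j _ => (Lp.memLp φ).integrable_mul (m0 j)
  have e2 : ∫ x, ζ x * (inner ℝ (v x) (B x) : ℝ) = ∑ j, ∫ x, B x j * (v x j * ζ x) := by
    rw [← integral_finsetSum]
    · simp only [inner_vec_eq_sum, Finset.mul_sum]
      congr 1; funext x
      exact Finset.sum_congr rfl fun j _ => by ring
    · exact fun j _ => (memLp_coord B j).integrable_mul (m1 j)
  rw [e1, e2, eq_neg_iff_add_eq_zero, ← Finset.sum_add_distrib, h0]

end Fourier

/-! ### Continuous fields as elements of `L²`. -/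

section L2

variable {d : ℕ}

theorem memLp_of_continuous {E : Type*} [NormedAddCommGroup E] {p : ℝ≥0∞}
    {f : UnitAddTorus (Fin d) → E} (hf : Continuous f) : MemLp f p := by
  obtain ⟨C, hC⟩ := (isCompact_range hf).isBounded.exists_norm_le
  exact MemLp.of_bound hf.aestronglyMeasurable C (.of_forall fun x => hC _ ⟨x, rfl⟩)

theorem toL2_eq_toLp {f : UnitAddTorus (Fin d) → Vec d} (hf : Continuous f) :
    toL2 f = (memLp_of_continuous hf).toLp f := dif_pos _

theorem coeFn_toL2 {f : UnitAddTorus (Fin d) → Vec d} (hf : Continuous f) :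
    toL2 f =ᵐ[volume] f := by
  rw [toL2_eq_toLp hf]
  exact MemLp.coeFn_toLp _

theorem inner_toL2_right (v : L2Field d) {f : UnitAddTorus (Fin d) → Vec d} (hf : Continuous f) :
    (inner ℝ v (toL2 f) : ℝ) = ∫ x, (inner ℝ (v x) (f x) : ℝ) := by
  rw [L2.inner_def]
  refine integral_congr_ae ?_
  filter_upwards [coeFn_toL2 hf] with x hx
  rw [hx]

theorem inner_toL2_left (v : L2Field d) {f : UnitAddTorus (Fin d) → Vec d} (hf : Continuous f) :
    (inner ℝ (toL2 f) v : ℝ) = ∫ x, (inner ℝ (f x) (v x) : ℝ) := by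
  rw [real_inner_comm, inner_toL2_right v hf]
  simp only [real_inner_comm]

theorem toL2_sub {f g : UnitAddTorus (Fin d) → Vec d} (hf : Continuous f) (hg : Continuous g) :
    toL2 (fun x => f x - g x) = toL2 f - toL2 g := by
  rw [toL2_eq_toLp hf, toL2_eq_toLp hg,
    toL2_eq_toLp (f := fun x => f x - g x) (by fun_prop)]
  exact MemLp.toLp_sub _ _

theorem toL2_zero : toL2 (fun _ : UnitAddTorus (Fin d) => (0 : Vec d)) = 0 := by
  rw [toL2_eq_toLp continuous_const]
  exact MemLp.toLp_zero _

theorem norm_sq_eq_sum_integral (v : L2Field d) : ‖v‖ ^ 2 = ∑ j, ∫ x, (v x j) ^ 2 := by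
  rw [← real_inner_self_eq_norm_sq, L2.inner_def, ← integral_finsetSum]
  · simp only [inner_vec_eq_sum, sq]
  · exact fun j _ => (memLp_coord v j).integrable_sq

/-- Expresses scalar test integrals as inner products in `L²`, so that weak-derivative relations
become visibly linear and closed. -/
theorem integral_coord_mul_eq_inner (v : L2Field d) (j : Fin d)
    {g : UnitAddTorus (Fin d) → ℝ} (hg : Continuous g) :
    ∫ x, v x j * g x = inner ℝ v (toL2 fun x => EuclideanSpace.single j (g x)) := by
  have : Continuous fun x => (EuclideanSpace.single j (g x) : Vec d) := by
    have h : (fun x => (EuclideanSpace.single j (g x) : Vec d)) =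
        fun x => g x • EuclideanSpace.single j (1 : ℝ) := by
      funext x; ext k; by_cases hk : k = j <;> simp [hk]
    rw [h]; fun_prop
  rw [inner_toL2_right v this]
  congr 1
  funext x
  rw [inner_vec_eq_sum, Finset.sum_eq_single j]
  · simp
  · intro k _ hk; simp [hk]
  · simp

instance instSecondCountableL2Field : SecondCountableTopology (L2Field d) := by
  have : Fact ((2 : ℝ≥0∞) ≠ ∞) := ⟨by simp⟩
  infer_instance

end L2

/-! ### Iterated partial derivatives and the polyharmonic operator. -/

section IteratedDerivatives

variable {d : ℕ} {F G : Type*} [NormedAddCommGroup F] [NormedSpace ℝ F]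
  [NormedAddCommGroup G] [NormedSpace ℝ G]

theorem pderivs_zero (I : Fin 0 → Fin d) (f : UnitAddTorus (Fin d) → F) : pderivs I f = f := by
  simp [pderivs]

theorem pderivs_succ {m : ℕ} (I : Fin (m + 1) → Fin d) (f : UnitAddTorus (Fin d) → F) :
    pderivs I f = pderiv (I 0) (pderivs (Fin.tail I) f) := by
  simp [pderivs, List.ofFn_succ, Fin.tail_def]

theorem IsSmooth.pderivs {m : ℕ} {f : UnitAddTorus (Fin d) → F} (hf : IsSmooth f)
    (I : Fin m → Fin d) : IsSmooth (pderivs I f) := by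
  induction m with
  | zero => rwa [pderivs_zero]
  | succ m ih => rw [pderivs_succ]; exact (ih _).pderiv _

theorem pderivs_clm (A : F →L[ℝ] G) {m : ℕ} {f : UnitAddTorus (Fin d) → F} (hf : IsSmooth f)
    (I : Fin m → Fin d) : pderivs I (fun y => A (f y)) = fun x => A (pderivs I f x) := by
  induction m with
  | zero => simp [pderivs_zero]
  | succ m ih =>
    funext x
    rw [pderivs_succ, ih, pderivs_succ]
    exact pderiv_clm A (hf.pderivs _) _ x

theorem pderiv_pderivs_comm {m : ℕ} {f : UnitAddTorus (Fin d) → F} (hf : IsSmooth f) (i : Fin d)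
    (I : Fin m → Fin d) : pderiv i (pderivs I f) = pderivs I (pderiv i f) := by
  induction m with
  | zero => simp [pderivs_zero]
  | succ m ih =>
    rw [pderivs_succ, pderiv_comm (hf.pderivs _), ih, ← pderivs_succ]

theorem pderiv_const_mul {𝔸 : Type*} [NormedRing 𝔸] [NormedAlgebra ℝ 𝔸] (c : 𝔸)
    {f : UnitAddTorus (Fin d) → 𝔸} (hf : IsSmooth f)
    (i : Fin d) (x : UnitAddTorus (Fin d)) :
    pderiv i (fun y => c * f y) x = c * pderiv i f x :=
  pderiv_eq_of_hasDerivAt ((hf.hasDerivAt i x).const_mul c)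

theorem pderivs_mFourier {m : ℕ} (I : Fin m → Fin d) (n : Fin d → ℤ) :
    pderivs I (UnitAddTorus.mFourier n) =
      fun x => (∏ k, (2 * Real.pi * Complex.I * n (I k))) * UnitAddTorus.mFourier n x := by
  induction m with
  | zero => simp [pderivs_zero]
  | succ m ih =>
    funext x
    rw [pderivs_succ, ih, pderiv_const_mul _ (isSmooth_mFourier n), pderiv_mFourier,
      Fin.prod_univ_succ]
    simp only [Fin.tail_def]
    ring

theorem integral_mul_pderivs {m : ℕ} {f g : UnitAddTorus (Fin d) → ℝ} (hf : IsSmooth f)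
    (hg : IsSmooth g) (I : Fin m → Fin d) :
    ∫ x, f x * pderivs I g x = (-1) ^ m * ∫ x, pderivs I f x * g x := by
  induction m generalizing f with
  | zero => simp [pderivs_zero]
  | succ m ih =>
    rw [pderivs_succ, integral_mul_pderiv hf (hg.pderivs _), ih (hf.pderiv _), pderivs_succ,
      pderiv_pderivs_comm hf]
    ring

theorem sum_fin_succ_fun {M : Type*} [AddCommMonoid M] {m : ℕ}
    (f : (Fin (m + 1) → Fin d) → M) :
    ∑ I, f I = ∑ i, ∑ I : Fin m → Fin d, f (Fin.cons i I) := by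
  rw [← Fintype.sum_prod_type', ← (Fin.consEquiv fun _ : Fin (m + 1) => Fin d).sum_comp]
  rfl

/-- The sum runs over ordered index sequences, so expanding the power of the Laplacian produces no
multinomial coefficients, and the same index set appears as in the definition of `K`. -/
theorem negLapPow_eq_sum {f : UnitAddTorus (Fin d) → F} (hf : IsSmooth f) (m : ℕ) :
    negLapPow m f = fun x => (-1 : ℝ) ^ m • ∑ I : Fin m → Fin d, pderivs I (pderivs I f) x := by
  induction m with
  | zero => funext x; simp [negLapPow, pderivs_zero]
  | succ m ih =>
    have hs : ∀ I : Fin m → Fin d, IsSmooth (pderivs I (pderivs I f)) := fun I =>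
      (hf.pderivs I).pderivs I
    have h1 : ∀ i, pderiv i (negLapPow m f) =
        fun x => (-1 : ℝ) ^ m • ∑ I : Fin m → Fin d, pderiv i (pderivs I (pderivs I f)) x := by
      intro i
      rw [ih]
      funext x
      have := pderiv_clm ((-1 : ℝ) ^ m • ContinuousLinearMap.id ℝ F)
        (IsSmooth.sum (s := Finset.univ) fun I _ => hs I) i x
      simp only [smul_apply, ContinuousLinearMap.id_apply] at this
      rw [this, pderiv_sum fun I _ => hs I]
    have h2 : ∀ i x, pderiv i (pderiv i (negLapPow m f)) x =
        (-1 : ℝ) ^ m • ∑ I : Fin m → Fin d, pderiv i (pderiv i (pderivs I (pderivs I f))) x := by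
      intro i x
      rw [h1]
      have := pderiv_clm ((-1 : ℝ) ^ m • ContinuousLinearMap.id ℝ F)
        (IsSmooth.sum (s := Finset.univ) fun I _ => (hs I).pderiv i) i x
      simp only [smul_apply, ContinuousLinearMap.id_apply] at this
      rw [this, pderiv_sum fun I _ => (hs I).pderiv i]
    funext x
    have h3 : negLapPow (m + 1) f x = -∑ i, pderiv i (pderiv i (negLapPow m f)) x := by
      simp only [negLapPow, Function.iterate_succ_apply']
    rw [h3, sum_fin_succ_fun]
    simp only [h2, ← Finset.smul_sum, pow_succ, mul_neg, mul_one, neg_smul]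
    congr 2
    refine Finset.sum_congr rfl fun i _ => Finset.sum_congr rfl fun I _ => ?_
    simp only [pderivs_succ, Fin.cons_zero, Fin.tail_cons]
    rw [pderiv_pderivs_comm (hf.pderivs I)]

theorem IsSmooth.negLapPow {f : UnitAddTorus (Fin d) → F} (hf : IsSmooth f) (m : ℕ) :
    IsSmooth (negLapPow m f) := by
  rw [negLapPow_eq_sum hf]
  exact (IsSmooth.sum (s := Finset.univ) fun I _ => (hf.pderivs I).pderivs I).clm
    ((-1 : ℝ) ^ m • ContinuousLinearMap.id ℝ F)

end IteratedDerivatives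

/-! ### The energy `K`: weak derivatives, Poincaré inequality, relative entropy, measurability. -/

section Energy

open UnitAddTorus

variable {d m : ℕ}

theorem IsWeakDerivs.unique {v : L2Field d} {W W' : (Fin m → Fin d) → L2Field d}
    (h : IsWeakDerivs m v W) (h' : IsWeakDerivs m v W') : W = W' := by
  funext I
  have key : ∀ j, (fun x => W I x j - W' I x j) =ᵐ[volume] 0 := by
    intro j
    refine ae_eq_zero_of_integral_mul_eq_zero ((memLp_coord _ j).sub (memLp_coord _ j)) ?_
    intro ζ hζ
    have e := (h I ζ hζ j).symm.trans (h' I ζ hζ j)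
    have e' := mul_left_cancel₀ (pow_ne_zero m (by norm_num)) e
    simp only [sub_mul]
    rw [integral_sub, e', sub_self]
    · exact (MemLp.mul_continuous (memLp_coord _ j) hζ.continuous).integrable (by norm_num)
    · exact (MemLp.mul_continuous (memLp_coord _ j) hζ.continuous).integrable (by norm_num)
  refine Lp.ext ?_
  filter_upwards [ae_all_iff.2 key] with x hx
  ext j
  simpa [sub_eq_zero] using hx j

theorem isWeakDerivs_toL2 {b : UnitAddTorus (Fin d) → Vec d} (hb : IsSmooth b) (m : ℕ) :
    IsWeakDerivs m (toL2 b) fun I => toL2 (pderivs I b) := by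
  intro I ζ hζ j
  have e1 : ∫ x, toL2 b x j * pderivs I ζ x = ∫ x, b x j * pderivs I ζ x := by
    refine integral_congr_ae ?_
    filter_upwards [coeFn_toL2 hb.continuous] with x hx
    rw [hx]
  have e2 : ∫ x, toL2 (pderivs I b) x j * ζ x = ∫ x, pderivs I b x j * ζ x := by
    refine integral_congr_ae ?_
    filter_upwards [coeFn_toL2 (hb.pderivs I).continuous] with x hx
    rw [hx]
  rw [e1, e2, integral_mul_pderivs (hb.coord j) hζ]
  have : pderivs I (fun x => b x j) = fun x => pderivs I b x j :=
    pderivs_clm (EuclideanSpace.proj (𝕜 := ℝ) j : Vec d →L[ℝ] ℝ) hb I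
  rw [this]

theorem isWeakDerivs_iff_inner {v : L2Field d} {W : (Fin m → Fin d) → L2Field d} :
    IsWeakDerivs m v W ↔ ∀ (I : Fin m → Fin d) (ζ : UnitAddTorus (Fin d) → ℝ), IsSmooth ζ →
      ∀ j : Fin d, (inner ℝ v (toL2 fun x => EuclideanSpace.single j (pderivs I ζ x)) : ℝ) =
        (-1) ^ m * inner ℝ (W I) (toL2 fun x => EuclideanSpace.single j (ζ x)) := by
  refine forall_congr' fun I => forall_congr' fun ζ => forall_congr' fun hζ =>
    forall_congr' fun j => ?_
  rw [integral_coord_mul_eq_inner _ _ (hζ.pderivs I).continuous,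
    integral_coord_mul_eq_inner _ _ hζ.continuous]

theorem IsWeakDerivs.sub {v v' : L2Field d} {W W' : (Fin m → Fin d) → L2Field d}
    (h : IsWeakDerivs m v W) (h' : IsWeakDerivs m v' W') :
    IsWeakDerivs m (v - v') (fun I => W I - W' I) := by
  rw [isWeakDerivs_iff_inner] at *
  intro I ζ hζ j
  simp only [inner_sub_left, mul_sub, h I ζ hζ j, h' I ζ hζ j]

theorem IsWeakDerivs.add {v v' : L2Field d} {W W' : (Fin m → Fin d) → L2Field d}
    (h : IsWeakDerivs m v W) (h' : IsWeakDerivs m v' W') :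
    IsWeakDerivs m (v + v') (fun I => W I + W' I) := by
  rw [isWeakDerivs_iff_inner] at *
  intro I ζ hζ j
  simp only [inner_add_left, mul_add, h I ζ hζ j, h' I ζ hζ j]

theorem IsWeakDerivs.K_eq {v : L2Field d} {W : (Fin m → Fin d) → L2Field d}
    (h : IsWeakDerivs m v W) : K m v = ENNReal.ofReal (1 / 2 * ∑ I, ‖W I‖ ^ 2) := by
  refine le_antisymm (iInf₂_le W h) (le_iInf₂ fun W' h' => ?_)
  rw [h.unique h']

theorem exists_isWeakDerivs_of_K_ne_top {v : L2Field d} (h : K m v ≠ ⊤) :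
    ∃ W, IsWeakDerivs m v W := by
  by_contra! hW
  exact h (by simp [K, hW])

/-- Poincaré inequality for mean zero fields with `∇^m v ∈ L²`. -/
theorem IsWeakDerivs.norm_sq_le {v : L2Field d} {W : (Fin m → Fin d) → L2Field d}
    (h : IsWeakDerivs m v W) (h0 : ∀ j, ∫ x, v x j = 0) : ‖v‖ ^ 2 ≤ ∑ I, ‖W I‖ ^ 2 := by
  simp_rw [norm_sq_eq_sum_integral]
  rw [Finset.sum_comm]
  refine Finset.sum_le_sum fun j _ => ?_
  have hW : ∀ I n, fcoeff (fun x => W I x j) n =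
      (-1) ^ m * ((∏ k, (2 * Real.pi * Complex.I * n (I k))) * fcoeff (fun x => v x j) n) := by
    intro I n
    have hs := isSmooth_mFourier n
    have hv : ∫ x, (v x j : ℂ) * pderivs I (mFourier n) x =
        (-1) ^ m * ∫ x, (W I x j : ℂ) * mFourier n x := by
      rw [integral_ofReal_mul (memLp_coord v j) (hs.pderivs I).continuous,
        integral_ofReal_mul (memLp_coord (W I) j) hs.continuous]
      have h1 := h I _ (hs.clm Complex.reCLM) j
      have h2 := h I _ (hs.clm Complex.imCLM) j
      simp only [pderivs_clm _ hs] at h1 h2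
      simp only [Complex.reCLM_apply, Complex.imCLM_apply] at h1 h2
      rw [h1, h2]
      push_cast
      ring
    have hmm : ((-1 : ℂ) ^ m) * (-1) ^ m = 1 := by rw [← mul_pow]; simp
    rw [pderivs_mFourier] at hv
    unfold fcoeff
    rw [← integral_const_mul, show (∫ x, (∏ k, (2 * Real.pi * Complex.I * n (I k))) *
      ((v x j : ℂ) * mFourier n x)) = ∫ x, (v x j : ℂ) *
        ((∏ k, (2 * Real.pi * Complex.I * n (I k))) * mFourier n x) by
        congr 1; funext x; ring, hv, ← mul_assoc, hmm, one_mul]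
  have hvsum := hasSum_norm_fcoeff_sq (memLp_coord v j)
  have hWsum : HasSum (fun n => ∑ I, ‖fcoeff (fun x => W I x j) n‖ ^ 2)
      (∑ I, ∫ x, (W I x j) ^ 2) :=
    hasSum_sum fun I _ => hasSum_norm_fcoeff_sq (memLp_coord (W I) j)
  refine hasSum_le (fun n => ?_) hvsum hWsum
  -- The zero mode vanishes by the mean condition. For `n ≠ 0` some `nᵢ ≠ 0`, and the single
  -- derivative `∂ᵢ^m` already multiplies the coefficient by a number of modulus `|2π nᵢ|^m ≥ 1`;
  -- hence the constant `1`.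
  by_cases hn : n = 0
  · have : fcoeff (fun x => v x j) n = 0 := by
      rw [hn, fcoeff]
      simp only [mFourier_zero, ContinuousMap.one_apply, mul_one]
      rw [integral_complex_ofReal, h0 j, Complex.ofReal_zero]
    rw [this]
    simp only [norm_zero, ne_eq, OfNat.ofNat_ne_zero, not_false_eq_true, zero_pow]
    exact Finset.sum_nonneg fun I _ => sq_nonneg _
  · obtain ⟨i, hi⟩ := Function.ne_iff.1 hn
    refine le_trans ?_ (Finset.single_le_sum (fun I _ => sq_nonneg _)
      (Finset.mem_univ (fun _ : Fin m => i)))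
    rw [hW]
    have hge : (1 : ℝ) ≤ ‖(2 * Real.pi * Complex.I * n i : ℂ)‖ := by
      simp only [Complex.norm_mul, Complex.norm_ofNat, Complex.norm_real, Complex.norm_I,
        Complex.norm_intCast, mul_one, Real.norm_eq_abs]
      have h1 : (1 : ℝ) ≤ |(n i : ℝ)| := by exact_mod_cast Int.one_le_abs hi
      have h2 : (1 : ℝ) ≤ 2 * |Real.pi| := by
        rw [abs_of_pos Real.pi_pos]; linarith [Real.pi_gt_three]
      nlinarith
    simp only [Finset.prod_const, norm_mul, norm_pow, norm_neg, norm_one, one_pow, one_mul]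
    have h1 : (1 : ℝ) ≤ ‖(2 * Real.pi * Complex.I * n i : ℂ)‖ ^ (Finset.univ : Finset (Fin m)).card :=
      one_le_pow₀ hge
    simp only [norm_mul] at h1
    exact pow_le_pow_left₀ (norm_nonneg _) (le_mul_of_one_le_left (norm_nonneg _) h1) 2

/-- The field `∂_I b` is itself an admissible test field in the definition of `W I = ∂_I v`; the
resulting sign `(-1)^m` is the one in `negLapPow_eq_sum`. -/
theorem inner_K'_eq {v : L2Field d} {W : (Fin m → Fin d) → L2Field d} (h : IsWeakDerivs m v W)
    {b : UnitAddTorus (Fin d) → Vec d} (hb : IsSmooth b) :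
    (inner ℝ (K' m b) v : ℝ) = ∑ I, inner ℝ (toL2 (pderivs I b)) (W I) := by
  have hcoord : ∀ (I : Fin m → Fin d) (j : Fin d), pderivs I (fun x => pderivs I b x j) =
      fun x => pderivs I (pderivs I b) x j := fun I j =>
    pderivs_clm (EuclideanSpace.proj (𝕜 := ℝ) j : Vec d →L[ℝ] ℝ) (hb.pderivs I) I
  have hI : ∀ I : Fin m → Fin d, (inner ℝ (toL2 (pderivs I b)) (W I) : ℝ) =
      (-1) ^ m * ∫ x, (inner ℝ (pderivs I (pderivs I b) x) (v x) : ℝ) := by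
    intro I
    rw [inner_toL2_left _ (hb.pderivs I).continuous]
    simp only [inner_vec_eq_sum]
    rw [integral_finsetSum, integral_finsetSum, Finset.mul_sum]
    · refine Finset.sum_congr rfl fun j _ => ?_
      have e := h I _ ((hb.pderivs I).coord j) j
      rw [hcoord] at e
      simp only [mul_comm (pderivs I (pderivs I b) _ j)]
      rw [e, ← mul_assoc, ← mul_pow]
      simp [mul_comm]
    · intro j _
      simp only [mul_comm (pderivs I (pderivs I b) _ j)]
      exact (MemLp.mul_continuous (memLp_coord v j)
        (((hb.pderivs I).pderivs I).coord j).continuous).integrable (by norm_num)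
    · intro j _
      simp only [mul_comm (pderivs I b _ j)]
      exact (MemLp.mul_continuous (memLp_coord (W I) j)
        ((hb.pderivs I).coord j).continuous).integrable (by norm_num)
  simp_rw [hI]
  rw [K', inner_toL2_left _ (hb.negLapPow m).continuous, negLapPow_eq_sum hb, ← Finset.mul_sum,
    ← integral_finsetSum, ← integral_const_mul]
  · simp only [inner_smul_left, sum_inner]
    simp
  · intro I _
    have := L2.integrable_inner (𝕜 := ℝ) (toL2 (pderivs I (pderivs I b))) v
    refine this.congr ?_
    filter_upwards [coeFn_toL2 ((hb.pderivs I).pderivs I).continuous] with x hx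
    rw [hx]

theorem K_toL2 {b : UnitAddTorus (Fin d) → Vec d} (hb : IsSmooth b) :
    K m (toL2 b) = ENNReal.ofReal (1 / 2 * ∑ I : Fin m → Fin d, ‖toL2 (pderivs I b)‖ ^ 2) :=
  (isWeakDerivs_toL2 hb m).K_eq

theorem K_sub_toL2_ne_top_iff (a : L2Field d) {b : UnitAddTorus (Fin d) → Vec d}
    (hb : IsSmooth b) : K m (a - toL2 b) ≠ ⊤ ↔ K m a ≠ ⊤ := by
  constructor
  · intro h
    obtain ⟨W, hW⟩ := exists_isWeakDerivs_of_K_ne_top h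
    have h2 := hW.add (isWeakDerivs_toL2 hb m)
    rw [sub_add_cancel] at h2
    rw [h2.K_eq]
    exact ENNReal.ofReal_ne_top
  · intro h
    obtain ⟨W, hW⟩ := exists_isWeakDerivs_of_K_ne_top h
    rw [(hW.sub (isWeakDerivs_toL2 hb m)).K_eq]
    exact ENNReal.ofReal_ne_top

/-- `K` is half a squared norm of the weak derivatives, so this is the expansion of `½‖W - W'‖²`,
with `inner_K'_eq` identifying the cross term. -/
theorem toReal_K_sub_toL2 {a : L2Field d} (ha : K m a ≠ ⊤) {b : UnitAddTorus (Fin d) → Vec d}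
    (hb : IsSmooth b) : (K m (a - toL2 b)).toReal =
      (K m a).toReal - (K m (toL2 b)).toReal - inner ℝ (K' m b) (a - toL2 b) := by
  obtain ⟨W, hW⟩ := exists_isWeakDerivs_of_K_ne_top ha
  have hs := hW.sub (isWeakDerivs_toL2 hb m)
  rw [hs.K_eq, hW.K_eq, K_toL2 hb, inner_K'_eq hs hb,
    ENNReal.toReal_ofReal (by positivity), ENNReal.toReal_ofReal (by positivity),
    ENNReal.toReal_ofReal (by positivity), ← mul_sub, ← Finset.sum_sub_distrib, Finset.mul_sum,
    Finset.mul_sum, ← Finset.sum_sub_distrib]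
  refine Finset.sum_congr rfl fun I _ => ?_
  rw [norm_sub_sq_real, inner_sub_right, real_inner_self_eq_norm_sq, real_inner_comm]
  ring

/-- When `K m a` is infinite both sides are `⊤`, because the subtracted quantities are finite;
otherwise the identity is one between real numbers. -/
theorem relEntropy_eq (a : L2Field d) {b : UnitAddTorus (Fin d) → Vec d} (hb : IsSmooth b) :
    relEntropy m a b = (K m (a - toL2 b) : EReal) := by
  have hbt : K m (toL2 b) ≠ ⊤ := by rw [K_toL2 hb]; exact ENNReal.ofReal_ne_top
  have hcoe : ∀ z : ℝ≥0∞, z ≠ ⊤ → (z : EReal) = ((z.toReal : ℝ) : EReal) := fun z hz =>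
    (EReal.coe_toReal (by simpa using hz) (by simp)).symm.trans (by simp)
  unfold relEntropy
  by_cases ha : K m a = ⊤
  · have : K m (a - toL2 b) = ⊤ := by
      by_contra h
      exact (K_sub_toL2_ne_top_iff a hb).1 h ha
    rw [ha, this, hcoe _ hbt]
    simp
  · rw [hcoe _ ha, hcoe _ hbt, hcoe _ ((K_sub_toL2_ne_top_iff a hb).2 ha),
      toReal_K_sub_toL2 ha hb]
    push_cast
    rfl

/-- Coercivity of the energy on `Sol d`, whose elements have zero mean. It absorbs the velocity
error in the entropy estimate and gives `v = ω` in the uniqueness statement. -/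
theorem norm_sq_le_two_mul_K {a : L2Field d} (ha : a ∈ Sol d) (h : K m a ≠ ⊤) :
    ‖a‖ ^ 2 ≤ 2 * (K m a).toReal := by
  obtain ⟨W, hW⟩ := exists_isWeakDerivs_of_K_ne_top h
  have hmean : ∀ j, ∫ x, a x j = 0 := by
    intro j
    simpa [inner_vec_eq_sum, PiLp.single_apply] using
      (mem_sol_iff.1 ha).2 (EuclideanSpace.single j 1)
  rw [hW.K_eq, ENNReal.toReal_ofReal (by positivity)]
  linarith [hW.norm_sq_le hmean]

/-- The pairs (field, weak derivatives) form a closed subset of a Polish space, and its projection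
to the first factor is injective since weak derivatives are unique. By Lusin–Souslin that projection
is a measurable embedding, and `K` is the extension by `⊤` of a continuous function along it. -/
theorem measurable_K (m : ℕ) [MeasurableSpace (L2Field d)] [BorelSpace (L2Field d)] :
    Measurable (K m : L2Field d → ℝ≥0∞) := by
  let X := {p : L2Field d × ((Fin m → Fin d) → L2Field d) | IsWeakDerivs m p.1 p.2}
  have hX : IsClosed X := by
    simp only [X, isWeakDerivs_iff_inner, ofPred_forall]
    refine isClosed_iInter fun I => isClosed_iInter fun ζ => isClosed_iInter fun _ =>
      isClosed_iInter fun j => isClosed_eq ?_ ?_ <;> fun_prop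
  have : PolishSpace X := hX.polishSpace
  let _ : MeasurableSpace X := borel X
  have : BorelSpace X := ⟨rfl⟩
  have hemb : MeasurableEmbedding (fun p : X => p.1.1) := by
    refine Continuous.measurableEmbedding (by fun_prop) ?_
    rintro ⟨⟨v, W⟩, h⟩ ⟨⟨v', W'⟩, h'⟩ heq
    obtain rfl : v = v' := heq
    obtain rfl : W = W' := IsWeakDerivs.unique h h'
    rfl
  have hg : Measurable fun p : X => ENNReal.ofReal (1 / 2 * ∑ I, ‖p.1.2 I‖ ^ 2) := by
    refine Continuous.measurable ?_
    refine ENNReal.continuous_ofReal.comp ?_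
    fun_prop
  have h := hemb.measurable_extend hg (measurable_const (a := (⊤ : ℝ≥0∞)))
  convert h using 1
  funext v
  by_cases hv : ∃ W, IsWeakDerivs m v W
  · obtain ⟨W, hW⟩ := hv
    rw [hW.K_eq]
    exact (hemb.injective.extend_apply
      (fun p : X => ENNReal.ofReal (1 / 2 * ∑ I, ‖p.1.2 I‖ ^ 2)) _ ⟨(v, W), hW⟩).symm
  · rw [Function.extend_apply']
    · by_contra h
      exact hv (exists_isWeakDerivs_of_K_ne_top h)
    · rintro ⟨p, rfl⟩
      exact hv ⟨_, p.2⟩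

end Energy

/-! ### Calculus on `[0,T] × 𝕋^d`, up to the end times. -/

section TimeDependent

open scoped ContDiff

variable {d : ℕ} {T : ℝ} {F G H : Type*} [NormedAddCommGroup F] [NormedSpace ℝ F]
  [NormedAddCommGroup G] [NormedSpace ℝ G] [NormedAddCommGroup H] [NormedSpace ℝ H]

theorem IsSmoothOn.isSmooth {f : ℝ → UnitAddTorus (Fin d) → F} (hf : IsSmoothOn T f) {t : ℝ}
    (ht : t ∈ Icc 0 T) : IsSmooth (f t) := by
  have h : ContDiffOn ℝ ∞ (fun x : Vec d => f t (proj x)) univ :=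
    ContDiffOn.comp (g := fun p : ℝ × Vec d => f p.1 (proj p.2)) hf
      (contDiff_const.prodMk contDiff_id).contDiffOn fun x _ => ⟨ht, mem_univ _⟩
  exact contDiffOn_univ.1 h

theorem IsSmoothOn.congr {f g : ℝ → UnitAddTorus (Fin d) → F} (hf : IsSmoothOn T f)
    (h : ∀ t ∈ Icc 0 T, g t = f t) : IsSmoothOn T g :=
  ContDiffOn.congr (f := fun p : ℝ × Vec d => f p.1 (proj p.2)) hf fun p hp => by rw [h _ hp.1]

theorem IsSmoothOn.const (c : F) : IsSmoothOn T (fun _ (_ : UnitAddTorus (Fin d)) => c) :=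
  contDiffOn_const

theorem IsSmoothOn.add {f g : ℝ → UnitAddTorus (Fin d) → F} (hf : IsSmoothOn T f)
    (hg : IsSmoothOn T g) : IsSmoothOn T (fun t x => f t x + g t x) := ContDiffOn.add hf hg

theorem IsSmoothOn.mul {f g : ℝ → UnitAddTorus (Fin d) → ℝ} (hf : IsSmoothOn T f)
    (hg : IsSmoothOn T g) : IsSmoothOn T (fun t x => f t x * g t x) := ContDiffOn.mul hf hg

theorem IsSmoothOn.inner {f g : ℝ → UnitAddTorus (Fin d) → Vec d} (hf : IsSmoothOn T f)
    (hg : IsSmoothOn T g) : IsSmoothOn T (fun t x => (inner ℝ (f t x) (g t x) : ℝ)) :=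
  ContDiffOn.inner ℝ hf hg

theorem IsSmoothOn.sum {ι : Type*} {s : Finset ι} {f : ι → ℝ → UnitAddTorus (Fin d) → F}
    (hf : ∀ i ∈ s, IsSmoothOn T (f i)) : IsSmoothOn T (fun t x => ∑ i ∈ s, f i t x) :=
  ContDiffOn.sum (f := fun i (p : ℝ × Vec d) => f i p.1 (proj p.2)) hf

theorem IsSmoothOn.clm (A : F →L[ℝ] G) {f : ℝ → UnitAddTorus (Fin d) → F}
    (hf : IsSmoothOn T f) : IsSmoothOn T (fun t x => A (f t x)) := A.contDiff.comp_contDiffOn hf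

theorem IsSmoothOn.coord {f : ℝ → UnitAddTorus (Fin d) → Vec d} (hf : IsSmoothOn T f)
    (i : Fin d) : IsSmoothOn T (fun t x => f t x i) := hf.clm (EuclideanSpace.proj i)

theorem isSmoothOn_vec {f : ℝ → UnitAddTorus (Fin d) → Vec d}
    (hf : ∀ i, IsSmoothOn T (fun t x => f t x i)) : IsSmoothOn T f := contDiffOn_euclidean.2 hf

theorem isSmoothOn_of_time {g : ℝ → F} (hg : ContDiff ℝ ∞ g) :
    IsSmoothOn T (fun t (_ : UnitAddTorus (Fin d)) => g t) :=
  (hg.comp contDiff_fst).contDiffOn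

theorem uniqueDiffOn_strip (hT : 0 < T) : UniqueDiffOn ℝ (Icc 0 T ×ˢ (univ : Set (Vec d))) :=
  (uniqueDiffOn_Icc hT).prod uniqueDiffOn_univ

theorem IsSmoothOn.pderiv_proj {f : ℝ → UnitAddTorus (Fin d) → F} (hf : IsSmoothOn T f)
    (i : Fin d) {t : ℝ} (ht : t ∈ Icc 0 T) (x : Vec d) :
    GFTorus.pderiv i (f t) (proj x) =
      fderivWithin ℝ (fun p : ℝ × Vec d => f p.1 (proj p.2)) (Icc 0 T ×ˢ univ) (t, x)
        (0, EuclideanSpace.single i 1) := by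
  rw [(hf.isSmooth ht).pderiv_proj]
  have h1 : HasFDerivWithinAt (fun p : ℝ × Vec d => f p.1 (proj p.2)) _
    (Icc 0 T ×ˢ univ) (t, x) :=
    ((ContDiffOn.differentiableOn hf (by simp)) (t, x) ⟨ht, mem_univ _⟩).hasFDerivWithinAt
  have h2 : HasFDerivWithinAt (fun y : Vec d => (t, y)) (ContinuousLinearMap.inr ℝ ℝ (Vec d))
      univ x := (hasFDerivAt_prodMk_right t x).hasFDerivWithinAt
  have h3 := HasFDerivWithinAt.comp (g := fun p : ℝ × Vec d => f p.1 (proj p.2)) x h1 h2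
    (fun y _ => ⟨ht, mem_univ _⟩)
  rw [hasFDerivWithinAt_univ] at h3
  have h4 : fderiv ℝ (fun y : Vec d => f t (proj y)) x = _ := h3.fderiv
  rw [h4]
  rfl

theorem IsSmoothOn.hasDerivWithinAt_proj {f : ℝ → UnitAddTorus (Fin d) → F}
    (hf : IsSmoothOn T f) {t : ℝ} (ht : t ∈ Icc 0 T) (x : Vec d) :
    HasDerivWithinAt (fun s => f s (proj x))
      (fderivWithin ℝ (fun p : ℝ × Vec d => f p.1 (proj p.2)) (Icc 0 T ×ˢ univ) (t, x) (1, 0))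
      (Icc 0 T) t := by
  have h1 : HasFDerivWithinAt (fun p : ℝ × Vec d => f p.1 (proj p.2)) _
    (Icc 0 T ×ˢ univ) (t, x) :=
    ((ContDiffOn.differentiableOn hf (by simp)) (t, x) ⟨ht, mem_univ _⟩).hasFDerivWithinAt
  have h2 : HasDerivWithinAt (fun s : ℝ => (s, x)) ((1 : ℝ), (0 : Vec d)) (Icc 0 T) t :=
    (hasDerivWithinAt_id t _).prodMk (hasDerivWithinAt_const t _ x)
  exact h1.comp_hasDerivWithinAt t h2 fun s hs => mk_mem_prod hs (mem_univ x)

theorem IsSmoothOn.tderiv_proj (hT : 0 < T) {f : ℝ → UnitAddTorus (Fin d) → F}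
    (hf : IsSmoothOn T f) {t : ℝ} (ht : t ∈ Icc 0 T) (x : Vec d) :
    GFTorus.tderiv T f t (proj x) =
      fderivWithin ℝ (fun p : ℝ × Vec d => f p.1 (proj p.2)) (Icc 0 T ×ˢ univ) (t, x) (1, 0) :=
  (hf.hasDerivWithinAt_proj ht x).derivWithin (uniqueDiffOn_Icc hT t ht)

theorem IsSmoothOn.hasDerivWithinAt (hT : 0 < T) {f : ℝ → UnitAddTorus (Fin d) → F}
    (hf : IsSmoothOn T f) {t : ℝ} (ht : t ∈ Icc 0 T) (x : UnitAddTorus (Fin d)) :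
    HasDerivWithinAt (fun s => f s x) (GFTorus.tderiv T f t x) (Icc 0 T) t := by
  obtain ⟨y, rfl⟩ := isOpenQuotientMap_proj.surjective x
  rw [hf.tderiv_proj hT ht]
  exact hf.hasDerivWithinAt_proj ht y

theorem tderiv_eq_of_hasDerivWithinAt (hT : 0 < T) {f : ℝ → UnitAddTorus (Fin d) → F}
    {t : ℝ} (ht : t ∈ Icc 0 T) {x : UnitAddTorus (Fin d)} {f' : F}
    (h : HasDerivWithinAt (fun s => f s x) f' (Icc 0 T) t) : tderiv T f t x = f' :=
  h.derivWithin (uniqueDiffOn_Icc hT t ht)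

theorem IsSmoothOn.pderiv (hT : 0 < T) {f : ℝ → UnitAddTorus (Fin d) → F} (hf : IsSmoothOn T f)
    (i : Fin d) : IsSmoothOn T (fun t => GFTorus.pderiv i (f t)) := by
  refine ContDiffOn.congr (f := fun p => fderivWithin ℝ
    (fun p : ℝ × Vec d => f p.1 (proj p.2)) (Icc 0 T ×ˢ univ) p (0, EuclideanSpace.single i 1))
    ?_ fun p hp => hf.pderiv_proj i hp.1 p.2
  exact (ContDiffOn.fderivWithin hf (uniqueDiffOn_strip hT) (by simp)).clm_apply contDiffOn_const

theorem IsSmoothOn.tderiv (hT : 0 < T) {f : ℝ → UnitAddTorus (Fin d) → F} (hf : IsSmoothOn T f) :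
    IsSmoothOn T (GFTorus.tderiv T f) := by
  refine ContDiffOn.congr (f := fun p => fderivWithin ℝ
    (fun p : ℝ × Vec d => f p.1 (proj p.2)) (Icc 0 T ×ˢ univ) p (1, 0))
    ?_ fun p hp => hf.tderiv_proj hT hp.1 p.2
  exact (ContDiffOn.fderivWithin hf (uniqueDiffOn_strip hT) (by simp)).clm_apply contDiffOn_const

theorem IsSmoothOn.grad (hT : 0 < T) {f : ℝ → UnitAddTorus (Fin d) → ℝ} (hf : IsSmoothOn T f) :
    IsSmoothOn T (fun t => grad (f t)) :=
  isSmoothOn_vec fun i => hf.pderiv hT i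

/-- Both orders are values of the second derivative within the strip. Its symmetry at `t = 0` and `t
= T` holds because, for `T > 0`, the strip lies in the closure of its interior. -/
theorem tderiv_pderiv (hT : 0 < T) {f : ℝ → UnitAddTorus (Fin d) → F} (hf : IsSmoothOn T f)
    (i : Fin d) {t : ℝ} (ht : t ∈ Icc 0 T) :
    tderiv T (fun s => pderiv i (f s)) t = pderiv i (tderiv T f t) := by
  funext x
  obtain ⟨y, rfl⟩ := isOpenQuotientMap_proj.surjective x
  set P : ℝ × Vec d → F := fun p => f p.1 (proj p.2)
  set S : Set (ℝ × Vec d) := Icc 0 T ×ˢ univ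
  have hS : UniqueDiffOn ℝ S := uniqueDiffOn_strip hT
  have hm : (t, y) ∈ S := ⟨ht, mem_univ _⟩
  have hd : DifferentiableWithinAt ℝ (fderivWithin ℝ P S) S (t, y) :=
    ((ContDiffOn.fderivWithin (m := ∞) hf hS (by simp)).differentiableOn (by simp)) _ hm
  have key : ∀ a b, fderivWithin ℝ (fun p => fderivWithin ℝ P S p a) S (t, y) b =
      fderivWithin ℝ (fderivWithin ℝ P S) S (t, y) b a := by
    intro a b
    rw [fderivWithin_clm_apply (hS _ hm) hd (differentiableWithinAt_const _)]
    simp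
  rw [(hf.pderiv hT i).tderiv_proj hT ht, (hf.tderiv hT).pderiv_proj i ht]
  have e1 := fderivWithin_congr (𝕜 := ℝ) (s := S) (x := (t, y))
    (fun p (hp : p ∈ S) => hf.pderiv_proj i hp.1 p.2) (hf.pderiv_proj i ht y)
  have e2 := fderivWithin_congr (𝕜 := ℝ) (s := S) (x := (t, y))
    (fun p (hp : p ∈ S) => hf.tderiv_proj hT hp.1 p.2) (hf.tderiv_proj hT ht y)
  rw [e1, e2, key, key]
  refine ContDiffWithinAt.isSymmSndFDerivWithinAt (n := ∞) (hf _ hm)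
    (by simpa using (WithTop.coe_le_coe.2 (le_top : (2 : ℕ∞) ≤ ⊤))) hS ?_ hm _ _
  rw [show interior S = Ioo 0 T ×ˢ univ by
    rw [interior_prod_eq, interior_Icc, interior_univ], closure_prod_eq, closure_Ioo hT.ne,
    closure_univ]
  exact hm

theorem IsSmoothOn.continuous_uncurry {f : ℝ → UnitAddTorus (Fin d) → F} (hf : IsSmoothOn T f) :
    Continuous (fun p : Icc 0 T × UnitAddTorus (Fin d) => f p.1 p.2) := by
  have hq : IsOpenQuotientMap (Prod.map id proj : Icc (0 : ℝ) T × Vec d → _) :=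
    IsOpenQuotientMap.id.prodMap isOpenQuotientMap_proj
  rw [← hq.continuous_comp_iff]
  exact (ContDiffOn.continuousOn hf).comp_continuous
    (f := fun p : Icc (0 : ℝ) T × Vec d => ((p.1 : ℝ), p.2)) (by fun_prop)
    fun p => ⟨p.1.2, mem_univ _⟩

/-- A field that is smooth on `[0,T] × 𝕋^d`, as a continuous curve of continuous functions. -/
theorem IsSmoothOn.exists_curve {f : ℝ → UnitAddTorus (Fin d) → F} (hT : 0 ≤ T)
    (hf : IsSmoothOn T f) : ∃ c : ℝ → C(UnitAddTorus (Fin d), F), Continuous c ∧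
      (∃ M, ∀ t, ‖c t‖ ≤ M) ∧ ∀ t ∈ Icc 0 T, ∀ x, c t x = f t x := by
  let c : C(Icc (0 : ℝ) T, C(UnitAddTorus (Fin d), F)) :=
    ContinuousMap.curry ⟨_, hf.continuous_uncurry⟩
  refine ⟨fun t => c (projIcc 0 T hT t), c.continuous.comp continuous_projIcc, ⟨‖c‖,
    fun t => c.norm_coe_le_norm _⟩, fun t ht x => ?_⟩
  have : c (projIcc 0 T hT t) x = f (projIcc 0 T hT t) x := rfl
  rw [this, projIcc_of_mem hT ht]

/-- Fubini, then the fundamental theorem of calculus at each fixed `x`; the derivative is replaced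
by a curve continuous on all of `ℝ` to make measurability automatic. -/
theorem integral_sub_eq_integral_tderiv (hT : 0 < T) {f : ℝ → UnitAddTorus (Fin d) → ℝ}
    (hf : IsSmoothOn T f) {t : ℝ} (ht : t ∈ Icc 0 T) :
    (∫ x, f t x) - ∫ x, f 0 x = ∫ s in (0 : ℝ)..t, ∫ x, tderiv T f s x := by
  obtain ⟨c, hc, -, hcf⟩ := (hf.tderiv hT).exists_curve hT.le
  have hcc : Continuous fun p : ℝ × UnitAddTorus (Fin d) => c p.1 p.2 := by fun_prop
  have h0 : (0 : ℝ) ∈ Icc 0 T := ⟨le_rfl, hT.le⟩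
  have hsub : Icc 0 t ⊆ Icc 0 T := Icc_subset_Icc_right ht.2
  have hae : ∀ᵐ s, s ∈ uIoc 0 t → s ∈ Icc 0 t := .of_forall fun s hs => by
    rw [uIoc_of_le ht.1] at hs; exact Ioc_subset_Icc_self hs
  have e1 : ∫ s in (0 : ℝ)..t, ∫ x, tderiv T f s x = ∫ s in (0 : ℝ)..t, ∫ x, c s x := by
    refine intervalIntegral.integral_congr fun s hs => ?_
    rw [uIcc_of_le ht.1] at hs
    simp only [hcf s (hsub hs)]
  rw [e1, intervalIntegral_integral_swap, ← integral_sub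
    (integrable_of_continuous (hf.isSmooth ht).continuous)
    (integrable_of_continuous (hf.isSmooth h0).continuous)]
  · refine integral_congr_ae (.of_forall fun x => ?_)
    have hd : ∀ s ∈ Icc 0 t, HasDerivWithinAt (fun s => f s x) (c s x) (Icc 0 t) s := by
      intro s hs
      rw [hcf s (hsub hs)]
      exact (hf.hasDerivWithinAt hT (hsub hs) x).mono hsub
    simp only
    rw [intervalIntegral.integral_eq_sub_of_hasDerivAt_of_le ht.1
      (fun s hs => (hd s hs).continuousWithinAt)
      (fun s hs => (hd s (Ioo_subset_Icc_self hs)).hasDerivAt (Icc_mem_nhds hs.1 hs.2))]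
    exact (hcc.comp (by fun_prop : Continuous fun s : ℝ => (s, x))).intervalIntegrable _ _
  · rw [uIoc_of_le ht.1]
    have hK : IsCompact (Icc 0 t ×ˢ (univ : Set (UnitAddTorus (Fin d)))) :=
      isCompact_Icc.prod isCompact_univ
    obtain ⟨M, hM⟩ := hK.exists_bound_of_continuousOn hcc.continuousOn
    refine Integrable.of_bound hcc.aestronglyMeasurable M ?_
    have : ∀ᵐ p ∂((volume.restrict (Ioc 0 t)).prod (volume : Measure (UnitAddTorus (Fin d)))),
        p.1 ∈ Ioc 0 t :=
      Measure.quasiMeasurePreserving_fst.ae (ae_restrict_mem measurableSet_Ioc)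
    filter_upwards [this] with p hp
    exact hM p ⟨Ioc_subset_Icc_self hp, mem_univ _⟩

end TimeDependent

/-! ### Measurability and integrability in time of `L²`-valued curves. -/

section Measurability

variable {d : ℕ} {T : ℝ}

/-- A form of Pettis' theorem: inner products with a dense sequence give a continuous injection into
`ℝ^ℕ`, hence by Lusin–Souslin a measurable embedding, through which measurability can be tested. -/
theorem measurable_of_measurable_inner {α E : Type*} [MeasurableSpace α] [NormedAddCommGroup E]
    [InnerProductSpace ℝ E] [CompleteSpace E] [SecondCountableTopology E] [MeasurableSpace E]
    [BorelSpace E] {f : α → E} (hf : ∀ g : E, Measurable fun a => (inner ℝ g (f a) : ℝ)) :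
    Measurable f := by
  have hemb : MeasurableEmbedding
      (fun (x : E) (n : ℕ) => (inner ℝ (TopologicalSpace.denseSeq E n) x : ℝ)) := by
    refine Continuous.measurableEmbedding (by fun_prop) fun x y h => ?_
    rw [← sub_eq_zero, ← inner_self_eq_zero (𝕜 := ℝ)]
    have hz : (fun z : E => (inner ℝ z (x - y) : ℝ)) = fun _ => 0 := by
      refine (TopologicalSpace.denseRange_denseSeq E).equalizer (by fun_prop) (by fun_prop) ?_
      funext n
      simpa [inner_sub_right, sub_eq_zero] using congrFun h n
    exact congrFun hz (x - y)
  exact hemb.measurable_comp_iff.1 (measurable_pi_lambda _ fun n => hf _)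

/-- Applied to `B`, which is continuous only for the weak topology. Extending the curve by its end
values outside `[0,T]` makes its inner products continuous on `ℝ`. -/
theorem aestronglyMeasurable_of_continuousOn_inner {E : Type*} [NormedAddCommGroup E]
    [InnerProductSpace ℝ E] [CompleteSpace E] [SecondCountableTopology E] {f : ℝ → E}
    (hT : 0 ≤ T) (hf : ∀ g : E, ContinuousOn (fun t => (inner ℝ g (f t) : ℝ)) (Icc 0 T)) :
    AEStronglyMeasurable f (volume.restrict (Icc 0 T)) := by
  borelize E
  have h : Measurable fun t => f (projIcc 0 T hT t) := by
    refine measurable_of_measurable_inner fun g => Continuous.measurable ?_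
    exact (hf g).comp_continuous (continuous_subtype_val.comp continuous_projIcc)
      fun t => (projIcc 0 T hT t).2
  refine h.aestronglyMeasurable.congr ?_
  filter_upwards [ae_restrict_mem measurableSet_Icc] with t ht
  rw [projIcc_of_mem hT ht]

theorem exists_continuous_toL2 (hT : 0 ≤ T) {f : ℝ → UnitAddTorus (Fin d) → Vec d}
    (hf : IsSmoothOn T f) : ∃ c : ℝ → L2Field d, Continuous c ∧ (∃ M, ∀ t, ‖c t‖ ≤ M) ∧
      ∀ t ∈ Icc 0 T, c t = toL2 (f t) := by
  obtain ⟨c, hc, ⟨M, hM⟩, hcf⟩ := hf.exists_curve hT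
  set Φ := ContinuousMap.toLp (E := Vec d) 2 (volume : Measure (UnitAddTorus (Fin d))) ℝ
  refine ⟨fun t => Φ (c t), by fun_prop, ⟨‖Φ‖ * M, fun t => ?_⟩, fun t ht => ?_⟩
  · exact (Φ.le_opNorm _).trans (mul_le_mul_of_nonneg_left (hM t) (norm_nonneg _))
  · refine Lp.ext ?_
    filter_upwards [ContinuousMap.coeFn_toLp (𝕜 := ℝ) (p := 2) volume (c t),
      coeFn_toL2 (hf.isSmooth ht).continuous] with x h1 h2
    rw [h1, h2, hcf t ht]

theorem integrableOn_inner_toL2 (hT : 0 ≤ T) {f : ℝ → UnitAddTorus (Fin d) → Vec d}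
    (hf : IsSmoothOn T f) {w : ℝ → L2Field d} (hw : IntegrableOn w (Icc 0 T)) :
    IntegrableOn (fun t => (inner ℝ (w t) (toL2 (f t)) : ℝ)) (Icc 0 T) := by
  obtain ⟨c, hc, ⟨M, hM⟩, hcf⟩ := exists_continuous_toL2 hT hf
  have h : IntegrableOn (fun t => (inner ℝ (w t) (c t) : ℝ)) (Icc 0 T) := by
    refine Integrable.mono' (hw.norm.mul_const M) (hw.1.inner hc.aestronglyMeasurable)
      (.of_forall fun t => ?_)
    exact (norm_inner_le_norm _ _).trans (mul_le_mul_of_nonneg_left (hM t) (norm_nonneg _))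
  exact h.congr_fun (fun t ht => by simp only [hcf t ht]) measurableSet_Icc

theorem integrableOn_toL2 (hT : 0 ≤ T) {f : ℝ → UnitAddTorus (Fin d) → Vec d}
    (hf : IsSmoothOn T f) : IntegrableOn (fun t => toL2 (f t)) (Icc 0 T) := by
  obtain ⟨c, hc, -, hcf⟩ := exists_continuous_toL2 hT hf
  exact (hc.continuousOn.integrableOn_Icc).congr_fun (fun t ht => hcf t ht) measurableSet_Icc

/-- Pointwise multiplication of square integrable fields by bounded matrix fields. -/
def multOp (d : ℕ) : Lp (Vec d →L[ℝ] Vec d) ∞ (volume : Measure (UnitAddTorus (Fin d))) →L[ℝ]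
    L2Field d →L[ℝ] L2Field d :=
  (ContinuousLinearMap.id ℝ (Vec d →L[ℝ] Vec d)).holderL volume ∞ 2 2

theorem coeFn_multOp (A : C(UnitAddTorus (Fin d), Vec d →L[ℝ] Vec d)) (u : L2Field d) :
    multOp d (ContinuousMap.toLp ∞ volume ℝ A) u =ᵐ[volume] fun x => A x (u x) := by
  have h := (ContinuousLinearMap.id ℝ (Vec d →L[ℝ] Vec d)).coeFn_holder (r := 2)
    (ContinuousMap.toLp ∞ (volume : Measure (UnitAddTorus (Fin d))) ℝ A) u
  filter_upwards [h, ContinuousMap.coeFn_toLp (𝕜 := ℝ) (p := ∞) volume A] with x h1 h2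
  rw [h2] at h1
  exact h1

theorem integrable_inner_clm {A : UnitAddTorus (Fin d) → Vec d →L[ℝ] Vec d} (hA : Continuous A)
    (u w : L2Field d) : Integrable fun x => (inner ℝ (A x (u x)) (w x) : ℝ) := by
  have := L2.integrable_inner (𝕜 := ℝ) (multOp d (ContinuousMap.toLp ∞ volume ℝ ⟨A, hA⟩) u) w
  refine this.congr ?_
  filter_upwards [coeFn_multOp ⟨A, hA⟩ u] with x hx
  rw [hx]
  rfl

/-- Serves the integrals containing `∇ω` and `div β`. Regarding the matrix field as a continuous
curve in `L^∞` turns the integral into a continuous bilinear expression, so measurability in time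
follows by composition. -/
theorem integrableOn_integral_inner_clm (hT : 0 ≤ T)
    {A : ℝ → UnitAddTorus (Fin d) → Vec d →L[ℝ] Vec d} (hA : IsSmoothOn T A)
    {u w : ℝ → L2Field d} (hu : AEStronglyMeasurable u (volume.restrict (Icc 0 T)))
    {M : ℝ} (huM : ∀ t ∈ Icc 0 T, ‖u t‖ ≤ M) (hw : IntegrableOn w (Icc 0 T)) :
    IntegrableOn (fun t => ∫ x, (inner ℝ (A t x (u t x)) (w t x) : ℝ)) (Icc 0 T) := by
  obtain ⟨c, hc, ⟨N, hN⟩, hcA⟩ := hA.exists_curve hT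
  set Φ := ContinuousMap.toLp (E := Vec d →L[ℝ] Vec d) ∞
    (volume : Measure (UnitAddTorus (Fin d))) ℝ
  have hΦ : ∀ t, ‖Φ (c t)‖ ≤ ‖Φ‖ * N := fun t =>
    (Φ.le_opNorm _).trans (mul_le_mul_of_nonneg_left (hN t) (norm_nonneg _))
  have h : IntegrableOn (fun t => (inner ℝ (multOp d (Φ (c t)) (u t)) (w t) : ℝ)) (Icc 0 T) := by
    refine Integrable.mono' (hw.norm.const_mul (‖multOp d‖ * (‖Φ‖ * N) * M)) ?_ ?_
    · refine AEStronglyMeasurable.inner ?_ hw.1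
      exact (multOp d).aestronglyMeasurable_comp₂
        (Φ.continuous.comp hc).aestronglyMeasurable hu
    · filter_upwards [ae_restrict_mem measurableSet_Icc] with t ht
      refine (norm_inner_le_norm _ _).trans (mul_le_mul_of_nonneg_right ?_ (norm_nonneg _))
      have hN0 : 0 ≤ ‖Φ‖ * N := (norm_nonneg _).trans (hΦ t)
      calc ‖multOp d (Φ (c t)) (u t)‖ ≤ ‖multOp d‖ * ‖Φ (c t)‖ * ‖u t‖ :=
            (multOp d).le_opNorm₂ _ _
        _ ≤ ‖multOp d‖ * (‖Φ‖ * N) * M := by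
          gcongr
          · exact hΦ t
          · exact huM t ht
  refine h.congr_fun (fun t ht => ?_) measurableSet_Icc
  simp only
  rw [L2.inner_def]
  refine integral_congr_ae ?_
  filter_upwards [coeFn_multOp (c t) (u t)] with x hx
  rw [hx, hcA t ht]

end Measurability

/-! ### Jacobian, divergence, and the matrix condition in the dissipation inequality. -/

section Jacobian

variable {d : ℕ}

/-- The Jacobian of a vector field, as a continuous linear map. -/
def jacL (z : UnitAddTorus (Fin d) → Vec d) (x : UnitAddTorus (Fin d)) : Vec d →L[ℝ] Vec d :=
  ∑ j, (EuclideanSpace.proj j : Vec d →L[ℝ] ℝ).smulRight (pderiv j z x)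

/-- The divergence of a vector field. -/
def dvg (z : UnitAddTorus (Fin d) → Vec d) (x : UnitAddTorus (Fin d)) : ℝ :=
  ∑ j, pderiv j z x j

theorem jacL_apply (z : UnitAddTorus (Fin d) → Vec d) (x : UnitAddTorus (Fin d)) (u : Vec d) :
    jacL z x u = ∑ j, u j • pderiv j z x := by
  simp [jacL]

theorem IsSmooth.jacL {z : UnitAddTorus (Fin d) → Vec d} (hz : IsSmooth z) :
    IsSmooth (jacL z) :=
  IsSmooth.sum fun j _ => (hz.pderiv j).clm
    (ContinuousLinearMap.smulRightL ℝ (Vec d) (Vec d) (EuclideanSpace.proj j : Vec d →L[ℝ] ℝ))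

theorem IsSmoothOn.jacL {T : ℝ} (hT : 0 < T) {z : ℝ → UnitAddTorus (Fin d) → Vec d}
    (hz : IsSmoothOn T z) : IsSmoothOn T (fun t => jacL (z t)) :=
  IsSmoothOn.sum fun j _ => (hz.pderiv hT j).clm
    (ContinuousLinearMap.smulRightL ℝ (Vec d) (Vec d) (EuclideanSpace.proj j : Vec d →L[ℝ] ℝ))

theorem IsSmooth.dvg {z : UnitAddTorus (Fin d) → Vec d} (hz : IsSmooth z) : IsSmooth (dvg z) :=
  IsSmooth.sum fun j _ => (hz.pderiv j).coord j

theorem IsSmoothOn.dvg {T : ℝ} (hT : 0 < T) {z : ℝ → UnitAddTorus (Fin d) → Vec d}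
    (hz : IsSmoothOn T z) : IsSmoothOn T (fun t => dvg (z t)) :=
  IsSmoothOn.sum fun j _ => (hz.pderiv hT j).coord j

theorem jacL_proj {z : UnitAddTorus (Fin d) → Vec d} (hz : IsSmooth z) (y : Vec d) :
    jacL z (proj y) = fderiv ℝ (fun y : Vec d => z (proj y)) y := by
  ext1 u
  have hu : u = ∑ j, u j • (EuclideanSpace.single j (1 : ℝ) : Vec d) := by
    ext k
    simp [Pi.single_apply]
  rw [jacL_apply]
  conv_rhs => rw [hu]
  simp only [map_sum, map_smul, hz.pderiv_proj]

theorem norm_jacL_apply_le {L : ℝ≥0} {z : UnitAddTorus (Fin d) → Vec d} (hz : IsSmooth z)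
    (hL : SpaceLipschitz L z) (x : UnitAddTorus (Fin d)) (u : Vec d) :
    ‖jacL z x u‖ ≤ L * ‖u‖ := by
  obtain ⟨y, rfl⟩ := isOpenQuotientMap_proj.surjective x
  rw [jacL_proj hz]
  exact ContinuousLinearMap.le_of_opNorm_le _ (norm_fderiv_le_of_lipschitz ℝ hL) u

/-- Each diagonal entry of the Jacobian is bounded by its operator norm, hence by `L`; this is the
source of the factor `d` in the final constant. -/
theorem abs_dvg_le {L : ℝ≥0} {z : UnitAddTorus (Fin d) → Vec d} (hz : IsSmooth z)
    (hL : SpaceLipschitz L z) (x : UnitAddTorus (Fin d)) : |dvg z x| ≤ d * L := by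
  have h : ∀ j, |pderiv j z x j| ≤ L := by
    intro j
    have h1 := norm_jacL_apply_le hz hL x (EuclideanSpace.single j 1)
    have h2 : jacL z x (EuclideanSpace.single j 1) = pderiv j z x := by
      rw [jacL_apply, Finset.sum_eq_single j]
      · simp
      · intro k _ hk; simp [hk]
      · simp
    rw [h2] at h1
    simp only [PiLp.norm_single, norm_one, mul_one] at h1
    exact (PiLp.norm_apply_le _ j).trans h1
  calc |dvg z x| ≤ ∑ j, |pderiv j z x j| := Finset.abs_sum_le_sum_abs _ _
    _ ≤ ∑ _j : Fin d, (L : ℝ) := Finset.sum_le_sum fun j _ => h j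
    _ = d * L := by simp

theorem pderiv_inner {f g : UnitAddTorus (Fin d) → Vec d} (hf : IsSmooth f) (hg : IsSmooth g)
    (i : Fin d) (x : UnitAddTorus (Fin d)) :
    pderiv i (fun y => (inner ℝ (f y) (g y) : ℝ)) x =
      inner ℝ (pderiv i f x) (g x) + inner ℝ (f x) (pderiv i g x) := by
  have h := (hf.hasDerivAt i x).inner ℝ (hg.hasDerivAt i x)
  simp only [AddCircle.coe_zero, Pi.single_zero, add_zero] at h
  rw [pderiv_eq_of_hasDerivAt h]
  ring

theorem inner_grad_inner {f g : UnitAddTorus (Fin d) → Vec d} (hf : IsSmooth f) (hg : IsSmooth g)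
    (x : UnitAddTorus (Fin d)) (u : Vec d) :
    (inner ℝ u (grad (fun y => (inner ℝ (f y) (g y) : ℝ)) x) : ℝ) =
      inner ℝ (jacL f x u) (g x) + inner ℝ (f x) (jacL g x u) := by
  rw [inner_vec_eq_sum, jacL_apply, jacL_apply, sum_inner, inner_sum, ← Finset.sum_add_distrib]
  refine Finset.sum_congr rfl fun i _ => ?_
  simp only [grad, pderiv_inner hf hg, inner_smul_left, inner_smul_right]
  simp
  ring

theorem inner_jacL_grad_comm {ψ : UnitAddTorus (Fin d) → ℝ} (hψ : IsSmooth ψ)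
    (x : UnitAddTorus (Fin d)) (u w : Vec d) :
    (inner ℝ (jacL (grad ψ) x u) w : ℝ) = inner ℝ u (jacL (grad ψ) x w) := by
  have h : ∀ i j, pderiv i (grad ψ) x j = pderiv j (grad ψ) x i := by
    intro i j
    rw [← pderiv_coord hψ.grad, ← pderiv_coord hψ.grad]
    exact congrFun (pderiv_comm hψ i j) x
  simp only [jacL_apply, inner_vec_eq_sum]
  simp only [WithLp.ofLp_sum, WithLp.ofLp_smul, Finset.sum_apply, Pi.smul_apply, smul_eq_mul,
    Finset.sum_mul, Finset.mul_sum]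
  rw [Finset.sum_comm]
  refine Finset.sum_congr rfl fun i _ => Finset.sum_congr rfl fun j _ => ?_
  rw [h]
  ring

theorem divTensor_eq {b : UnitAddTorus (Fin d) → Vec d} (hb : IsSmooth b)
    (x : UnitAddTorus (Fin d)) : divTensor b x = jacL b x (b x) + dvg b x • b x := by
  ext i
  simp only [divTensor, jacL_apply, dvg, pderiv_mul (hb.coord _) (hb.coord _), pderiv_coord hb,
    WithLp.ofLp_add, Pi.add_apply, WithLp.ofLp_sum, WithLp.ofLp_smul, Finset.sum_apply,
    Pi.smul_apply, smul_eq_mul, Finset.sum_add_distrib, Finset.sum_mul]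
  congr 1 <;> exact Finset.sum_congr rfl fun j _ => by ring

theorem sum_mul_symMatrix {z : UnitAddTorus (Fin d) → Vec d} (hz : IsSmooth z) (r : ℝ)
    (x : UnitAddTorus (Fin d)) (u : Vec d) :
    ∑ i, ∑ j, u i * u j * symMatrix r z x i j =
      r * (inner ℝ u u : ℝ) + 2 * inner ℝ (jacL z x u) u := by
  have h1 : ∑ i, ∑ j, u i * u j * jac z x i j = inner ℝ (jacL z x u) u := by
    simp only [jacL_apply, inner_vec_eq_sum, jac, Matrix.of_apply, pderiv_coord hz,
      WithLp.ofLp_sum, WithLp.ofLp_smul, Finset.sum_apply, Pi.smul_apply, smul_eq_mul,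
      Finset.sum_mul]
    exact Finset.sum_congr rfl fun i _ => Finset.sum_congr rfl fun j _ => by ring
  have h2 : ∑ i, ∑ j, u i * u j * jac z x j i = inner ℝ (jacL z x u) u := by
    rw [← h1, Finset.sum_comm]
    exact Finset.sum_congr rfl fun i _ => Finset.sum_congr rfl fun j _ => by ring
  simp only [symMatrix, Matrix.add_apply, Matrix.smul_apply, Matrix.transpose_apply, mul_add,
    Finset.sum_add_distrib, h1, h2, Matrix.one_apply, inner_vec_eq_sum, smul_eq_mul, mul_ite,
    mul_one, mul_zero, Finset.sum_ite_eq, Finset.mem_univ, if_true, Finset.mul_sum]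
  rw [add_assoc, ← two_mul]
  congr 1
  · exact Finset.sum_congr rfl fun i _ => by ring
  · rw [Finset.mul_sum]

/-- Since `|∇z u · u| ≤ L|u|²`, the weight `r ≥ 2L` compensates the symmetric part of the Jacobian.
This is what makes `ω` an admissible test field. -/
theorem quadraticForm_nonneg {L : ℝ≥0} {z : UnitAddTorus (Fin d) → Vec d} (hz : IsSmooth z)
    (hL : SpaceLipschitz L z) {r : ℝ} (hr : 2 * L ≤ r) (x : UnitAddTorus (Fin d)) (u : Vec d) :
    0 ≤ r * (inner ℝ u u : ℝ) + 2 * inner ℝ (jacL z x u) u := by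
  have h3 := abs_le.1 (abs_real_inner_le_norm (jacL z x u) u)
  have h4 := mul_le_mul_of_nonneg_right (norm_jacL_apply_le hz hL x u) (norm_nonneg u)
  rw [real_inner_self_eq_norm_sq]
  nlinarith [h3.1, sq_nonneg ‖u‖, mul_le_mul_of_nonneg_right hr (sq_nonneg ‖u‖)]

theorem symMatrix_posSemidef {L : ℝ≥0} {z : UnitAddTorus (Fin d) → Vec d} (hz : IsSmooth z)
    (hL : SpaceLipschitz L z) {r : ℝ} (hr : 2 * L ≤ r) (x : UnitAddTorus (Fin d)) :
    (symMatrix r z x).PosSemidef := by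
  refine Matrix.PosSemidef.of_dotProduct_mulVec_nonneg ?_ fun y => ?_
  · rw [Matrix.IsHermitian, Matrix.conjTranspose_eq_transpose_of_trivial]
    simp only [symMatrix, Matrix.transpose_add, Matrix.transpose_smul, Matrix.transpose_one,
      Matrix.transpose_transpose]
    abel
  · have h := sum_mul_symMatrix hz r x (WithLp.toLp 2 y)
    have h2 : star y ⬝ᵥ (symMatrix r z x).mulVec y =
        ∑ i, ∑ j, y i * y j * symMatrix r z x i j := by
      simp only [dotProduct, Matrix.mulVec, Finset.mul_sum, star_trivial]
      exact Finset.sum_congr rfl fun i _ => Finset.sum_congr rfl fun j _ => by ring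
    rw [h2]
    exact (quadraticForm_nonneg hz hL hr x _).trans_eq h.symm

end Jacobian

/-! ### Multiplication operators on `L²`. -/

section Operators

variable {d : ℕ}

/-- Pointwise multiplication by a continuous matrix field, on `L²`. -/
def contOp (A : UnitAddTorus (Fin d) → Vec d →L[ℝ] Vec d) (hA : Continuous A) :
    L2Field d →L[ℝ] L2Field d :=
  multOp d (ContinuousMap.toLp ∞ volume ℝ ⟨A, hA⟩)

variable {A : UnitAddTorus (Fin d) → Vec d →L[ℝ] Vec d} (hA : Continuous A)

theorem coeFn_contOp (u : L2Field d) : contOp A hA u =ᵐ[volume] fun x => A x (u x) :=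
  coeFn_multOp ⟨A, hA⟩ u

theorem inner_contOp (u w : L2Field d) :
    (inner ℝ (contOp A hA u) w : ℝ) = ∫ x, (inner ℝ (A x (u x)) (w x) : ℝ) := by
  rw [L2.inner_def]
  refine integral_congr_ae ?_
  filter_upwards [coeFn_contOp hA u] with x hx
  rw [hx]

theorem norm_contOp_le {C : ℝ} (hC : ∀ x u, ‖A x u‖ ≤ C * ‖u‖) (u : L2Field d) :
    ‖contOp A hA u‖ ≤ C * ‖u‖ := by
  refine Lp.norm_le_mul_norm_of_ae_le_mul ?_
  filter_upwards [coeFn_contOp hA u] with x hx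
  rw [hx]
  exact hC x _

theorem contOp_toL2 {f : UnitAddTorus (Fin d) → Vec d} (hf : Continuous f) :
    contOp A hA (toL2 f) = toL2 (fun x => A x (f x)) := by
  refine Lp.ext ?_
  filter_upwards [coeFn_contOp hA (toL2 f), coeFn_toL2 hf,
    coeFn_toL2 (show Continuous fun x => A x (f x) by fun_prop)] with x h1 h2 h3
  rw [h1, h2, h3]

theorem inner_contOp_comm (hs : ∀ x u w, (inner ℝ (A x u) w : ℝ) = inner ℝ u (A x w))
    (u w : L2Field d) : (inner ℝ (contOp A hA u) w : ℝ) = inner ℝ u (contOp A hA w) := by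
  rw [inner_contOp, real_inner_comm, inner_contOp]
  congr 1
  funext x
  rw [hs, real_inner_comm]

end Operators

/-! ### Orthogonality relations and the cancellation of cubic terms. -/

section Identities

variable {d : ℕ}

theorem sol_inner_toL2_grad {v : L2Field d} (hv : v ∈ Sol d) {ζ : UnitAddTorus (Fin d) → ℝ}
    (hζ : IsSmooth ζ) : (inner ℝ v (toL2 (grad ζ)) : ℝ) = 0 := by
  rw [inner_toL2_right _ hζ.grad.continuous]
  exact (mem_sol_iff.1 hv).1 ζ hζ

/-- By symmetry of the Hessian, `(D²ψ)∇ψ = ½∇|∇ψ|²` is a gradient. -/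
theorem sol_inner_jacL_grad {v : L2Field d} (hv : v ∈ Sol d) {ψ : UnitAddTorus (Fin d) → ℝ}
    (hψ : IsSmooth ψ) :
    (inner ℝ v (toL2 fun x => jacL (grad ψ) x (grad ψ x)) : ℝ) = 0 := by
  have h := (mem_sol_iff.1 hv).1 _ (hψ.grad.inner hψ.grad)
  have hc : Continuous fun x => jacL (grad ψ) x (grad ψ x) :=
    hψ.grad.jacL.continuous.clm_apply hψ.grad.continuous
  rw [inner_toL2_right _ hc]
  have e : ∀ x, (inner ℝ (v x) (grad (fun y => (inner ℝ (grad ψ y) (grad ψ y) : ℝ)) x) : ℝ) =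
      2 * inner ℝ (v x) (jacL (grad ψ) x (grad ψ x)) := by
    intro x
    rw [inner_grad_inner hψ.grad hψ.grad, real_inner_comm _ (grad ψ x),
      inner_jacL_grad_comm hψ]
    ring
  simp_rw [e, integral_const_mul] at h
  linarith

theorem integral_dvg_mul {z : UnitAddTorus (Fin d) → Vec d} (hz : IsSmooth z)
    {ζ : UnitAddTorus (Fin d) → ℝ} (hζ : IsSmooth ζ) :
    ∫ x, dvg z x * ζ x = -∫ x, (inner ℝ (z x) (grad ζ x) : ℝ) := by
  simp only [dvg, Finset.sum_mul, inner_vec_eq_sum, grad]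
  rw [integral_finsetSum, integral_finsetSum, ← Finset.sum_neg_distrib]
  · refine Finset.sum_congr rfl fun j _ => ?_
    rw [integral_mul_pderiv (hz.coord j) hζ, neg_neg]
    simp only [pderiv_coord hz]
  · exact fun j _ => integrable_of_continuous ((hz.coord j).mul (hζ.pderiv j)).continuous
  · exact fun j _ => integrable_of_continuous (((hz.pderiv j).coord j).mul hζ).continuous

theorem dvg_eq_zero_of_mem_sol {z : UnitAddTorus (Fin d) → Vec d} (hz : IsSmooth z)
    (h : toL2 z ∈ Sol d) : dvg z =ᵐ[volume] 0 := by
  refine ae_eq_zero_of_integral_mul_eq_zero (memLp_of_continuous hz.dvg.continuous) ?_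
  intro ζ hζ
  have e := sol_inner_toL2_grad h hζ
  rw [inner_toL2_left _ hz.continuous] at e
  rw [integral_dvg_mul hz hζ, neg_eq_zero, ← e]
  refine integral_congr_ae ?_
  filter_upwards [coeFn_toL2 hζ.grad.continuous] with x hx
  rw [hx]

theorem IsWeakGrad.inner_toL2 {φ : L2Scalar d} {B : L2Field d} (hB : IsWeakGrad φ B)
    {z : UnitAddTorus (Fin d) → Vec d} (hz : IsSmooth z) :
    (inner ℝ B (toL2 z) : ℝ) = -∫ x, φ x * dvg z x := by
  rw [inner_toL2_right _ hz.continuous]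
  simp only [inner_vec_eq_sum, dvg, Finset.mul_sum]
  rw [integral_finsetSum, integral_finsetSum, ← Finset.sum_neg_distrib]
  · refine Finset.sum_congr rfl fun i _ => ?_
    have := hB _ (hz.coord i) i
    simp only [pderiv_coord hz] at this
    rw [this, neg_neg]
  · exact fun i _ => (MemLp.mul_continuous (Lp.memLp φ)
      ((hz.pderiv i).coord i).continuous).integrable (by norm_num)
  · exact fun i _ => (MemLp.mul_continuous (memLp_coord B i)
      (hz.coord i).continuous).integrable (by norm_num)

/-- Gradients are orthogonal to the divergence of the antisymmetric tensor `b ⊗ z - z ⊗ b`. -/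
theorem IsWeakGrad.inner_commutator {φ : L2Scalar d} {B : L2Field d} (hB : IsWeakGrad φ B)
    {b z : UnitAddTorus (Fin d) → Vec d} (hb : IsSmooth b) (hz : IsSmooth z)
    (hsol : toL2 z ∈ Sol d) :
    (inner ℝ B (toL2 fun x => jacL b x (z x) - jacL z x (b x) - dvg b x • z x) : ℝ) = 0 := by
  -- `V` is the row divergence of the antisymmetric tensor `a = b ⊗ z - z ⊗ b`. By `hVeq` it is the
  -- field of the statement plus `(div z) b`, and `div z` vanishes almost everywhere.
  let a : Fin d → Fin d → UnitAddTorus (Fin d) → ℝ := fun i j x => b x i * z x j - z x i * b x j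
  have ha : ∀ i j, IsSmooth (a i j) := fun i j =>
    ((hb.coord i).mul (hz.coord j)).sub ((hz.coord i).mul (hb.coord j))
  let V : UnitAddTorus (Fin d) → Vec d := fun x => WithLp.toLp 2 fun i => ∑ j, pderiv j (a i j) x
  have hV : IsSmooth V := isSmooth_vec fun i =>
    IsSmooth.sum (s := Finset.univ) (f := fun j => pderiv j (a i j)) fun j _ => (ha i j).pderiv j
  have hVeq : ∀ x, V x = jacL b x (z x) - jacL z x (b x) - dvg b x • z x + dvg z x • b x := by
    intro x
    have hpa : ∀ i j, pderiv j (a i j) x = (pderiv j b x i * z x j + b x i * pderiv j z x j) -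
        (pderiv j z x i * b x j + z x i * pderiv j b x j) := by
      intro i j
      have h1 := pderiv_add ((hb.coord i).mul (hz.coord j)) ((hz.coord i).mul (hb.coord j)).neg j x
      rw [pderiv_neg ((hz.coord i).mul (hb.coord j)), pderiv_mul (hb.coord i) (hz.coord j),
        pderiv_mul (hz.coord i) (hb.coord j)] at h1
      simp only [pderiv_coord hb, pderiv_coord hz, ← sub_eq_add_neg] at h1
      exact h1
    ext i
    simp only [V, hpa, jacL_apply, dvg, WithLp.ofLp_add, WithLp.ofLp_sub, Pi.add_apply,
      Pi.sub_apply, WithLp.ofLp_sum, WithLp.ofLp_smul, Finset.sum_apply, Pi.smul_apply,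
      smul_eq_mul, Finset.sum_mul, ← Finset.sum_sub_distrib, ← Finset.sum_add_distrib]
    exact Finset.sum_congr rfl fun j _ => by ring
  have hdiv : ∀ x, dvg V x = 0 := by
    intro x
    have h1 : dvg V x = ∑ i, ∑ j, pderiv i (pderiv j (a i j)) x := by
      refine Finset.sum_congr rfl fun i _ => ?_
      rw [← pderiv_coord hV]
      exact pderiv_sum (s := Finset.univ) (f := fun j => pderiv j (a i j))
        (fun j _ => (ha i j).pderiv j) i x
    have h2 : ∀ i j, pderiv i (pderiv j (a i j)) x = -pderiv j (pderiv i (a j i)) x := by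
      intro i j
      have e1 : a i j = fun x => -a j i x := by funext x; simp only [a]; ring
      have e2 : pderiv j (a i j) = fun x => -pderiv j (a j i) x := by
        funext y; rw [e1]; exact pderiv_neg (ha j i) j y
      rw [e2, pderiv_neg ((ha j i).pderiv j), pderiv_comm (ha j i)]
    -- Exchanging the indices in the double sum changes its sign by antisymmetry, while mixed
    -- derivatives commute; so `V` is divergence free and orthogonal to the gradient `B`.
    have h3 : dvg V x = -dvg V x := by
      rw [h1]
      conv_lhs => rw [Finset.sum_comm]
      rw [← Finset.sum_neg_distrib]
      refine Finset.sum_congr rfl fun i _ => ?_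
      rw [← Finset.sum_neg_distrib]
      exact Finset.sum_congr rfl fun j _ => h2 j i
    linarith
  have hcomm : IsSmooth fun x => jacL b x (z x) - jacL z x (b x) - dvg b x • z x := by
    have h4 : (fun x => jacL b x (z x) - jacL z x (b x) - dvg b x • z x) =
        fun x => V x - dvg z x • b x := by
      funext x; rw [hVeq]; abel
    rw [h4]
    exact hV.sub (hz.dvg.bilin (ContinuousLinearMap.lsmul ℝ ℝ) hb)
  have heq : toL2 (fun x => jacL b x (z x) - jacL z x (b x) - dvg b x • z x) = toL2 V := by
    refine Lp.ext ?_
    filter_upwards [coeFn_toL2 hcomm.continuous, coeFn_toL2 hV.continuous,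
      dvg_eq_zero_of_mem_sol hz hsol] with x h1 h2 h3
    rw [h1, h2, hVeq, h3]
    simp
  rw [heq, hB.inner_toL2 hV]
  simp [hdiv]

/-- The algebraic identity behind the relative entropy estimate. -/
theorem relative_energy_identity {E : Type*} [NormedAddCommGroup E] [InnerProductSpace ℝ E]
    (J H S : E →L[ℝ] E) {B b v o g p : E} (hH : ∀ u w, (inner ℝ (H u) w : ℝ) = inner ℝ u (H w))
    (hS : ∀ u w, (inner ℝ (S u) w : ℝ) = inner ℝ u (S w))
    (hg : ∀ u, (inner ℝ u g : ℝ) = inner ℝ (J u) b + inner ℝ o (H u)) (hp : p = H b + S b)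
    (z1 : (inner ℝ B (H o - J b - S o) : ℝ) = 0) (z2 : (inner ℝ v (H b) : ℝ) = 0)
    (z3 : (inner ℝ o (H b) : ℝ) = 0) :
    (inner ℝ (J B) B : ℝ) + inner ℝ (S B) v - inner ℝ (B - b) g - inner ℝ p (v - o) =
      inner ℝ (J (B - b)) (B - b) + inner ℝ (S (B - b)) (v - o) := by
  have e1 : (inner ℝ (H b) v : ℝ) = 0 := by rw [real_inner_comm]; exact z2
  have e2 : (inner ℝ (H b) o : ℝ) = 0 := by rw [real_inner_comm]; exact z3
  have e3 : (inner ℝ o (H B) : ℝ) = inner ℝ B (H o) := by rw [← hH, real_inner_comm]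
  have e4 : (inner ℝ (J b) B : ℝ) = inner ℝ B (J b) := real_inner_comm _ _
  have e5 : (inner ℝ (S B) o : ℝ) = inner ℝ B (S o) := hS _ _
  -- After expansion the two sides differ only by `-((B, H o - J b - S o))` and by pairings of `v`
  -- and `o` with `H b`, which vanish by `z1`, `z2`, `z3`. No symmetry of `J` is needed.
  rw [hg, hp]
  simp only [map_sub, inner_sub_left, inner_sub_right, inner_add_left] at *
  linarith

end Identities

/-! ### The relative entropy estimate at a fixed time. -/

section Pointwise

variable {d m : ℕ}

theorem inner_leray_of_mem_sol {w : L2Field d} (hw : w ∈ Sol d) (p : L2Field d) :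
    (inner ℝ (leray d p) w : ℝ) = inner ℝ p w := by
  rw [leray, Submodule.inner_starProjection_left_eq_right,
    Submodule.starProjection_eq_self_iff.2 hw]

/-- The instantaneous relative entropy estimate. -/
theorem relative_entropy_estimate {L : ℝ≥0} {φ : L2Scalar d} {B v : L2Field d}
    (hB : IsWeakGrad φ B) (hv : v ∈ Sol d) (hK : K m v ≠ ⊤) {ψ : UnitAddTorus (Fin d) → ℝ}
    (hψ : IsSmooth ψ) {β ω β' : UnitAddTorus (Fin d) → Vec d} (hβ : β = grad ψ)
    (hω : IsSmooth ω) (hsol : toL2 ω ∈ Sol d)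
    (hβL : SpaceLipschitz L β) (hωL : SpaceLipschitz L ω) (hβ' : IsSmooth β') :
    (K m (v - toL2 ω)).toReal -
      2 * (-inner ℝ (B - toL2 β)
          (toL2 fun x => grad (fun y => inner ℝ (ω y) (β y)) x + β' x)
        - inner ℝ (leray d (toL2 (divTensor β)) + K' m ω) (v - toL2 ω)) ≤
      2 * (K m v).toReal - 2 * (K m (toL2 ω)).toReal
        + 2 * (∫ x, (inner ℝ (jacL ω x (B x)) (B x) : ℝ))
        + 2 * inner ℝ B (toL2 β')
        + 2 * (∫ x, (inner ℝ ((dvg β x • ContinuousLinearMap.id ℝ (Vec d)) (B x)) (v x) : ℝ))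
        - 2 * inner ℝ (toL2 β) (toL2 β')
        + (2 * L + 2 * (d * L) ^ 2) * ‖B - toL2 β‖ ^ 2 := by
  have hβs : IsSmooth β := hβ ▸ hψ.grad
  have cS : Continuous fun x => dvg β x • ContinuousLinearMap.id ℝ (Vec d) :=
    hβs.dvg.continuous.smul continuous_const
  -- The abstract identity is applied with multiplication by `∇ω` (`J`), by the Hessian `∇β` (`H`)
  -- and by `div β` (`S`); `g = ∇(ω·β)` and `p = ∇·(β ⊗ β)`.
  set J := contOp _ hω.jacL.continuous
  set H := contOp _ hβs.jacL.continuous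
  set S := contOp _ cS
  set b := toL2 β
  set o := toL2 ω
  set g := toL2 (grad fun y => (inner ℝ (ω y) (β y) : ℝ))
  set p := toL2 (divTensor β)
  have hgs := (hω.inner hβs).grad
  have hsum : toL2 (fun x => grad (fun y => (inner ℝ (ω y) (β y) : ℝ)) x + β' x) =
      g + toL2 β' := by
    refine Lp.ext ?_
    filter_upwards [coeFn_toL2 (hgs.add hβ').continuous, coeFn_toL2 hgs.continuous,
      coeFn_toL2 hβ'.continuous, Lp.coeFn_add g (toL2 β')] with x h1 h2 h3 h4
    rw [h1, h4, Pi.add_apply, h2, h3]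
  have hJb : J b = toL2 fun x => jacL ω x (β x) := contOp_toL2 _ hβs.continuous
  have hHb : H b = toL2 fun x => jacL β x (β x) := contOp_toL2 _ hβs.continuous
  have hHo : H o = toL2 fun x => jacL β x (ω x) := contOp_toL2 _ hω.continuous
  have hSb : S b = toL2 fun x => dvg β x • β x := contOp_toL2 _ hβs.continuous
  have hSo : S o = toL2 fun x => dvg β x • ω x := contOp_toL2 _ hω.continuous
  have c1 : Continuous fun x => jacL β x (ω x) := hβs.jacL.continuous.clm_apply hω.continuous
  have c2 : Continuous fun x => jacL ω x (β x) := hω.jacL.continuous.clm_apply hβs.continuous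
  have c3 : Continuous fun x => dvg β x • ω x := hβs.dvg.continuous.smul hω.continuous
  have c4 : Continuous fun x => jacL β x (β x) := hβs.jacL.continuous.clm_apply hβs.continuous
  have c5 : Continuous fun x => dvg β x • β x := hβs.dvg.continuous.smul hβs.continuous
  have hH : ∀ u w, (inner ℝ (H u) w : ℝ) = inner ℝ u (H w) :=
    inner_contOp_comm _ (by rw [hβ]; exact inner_jacL_grad_comm hψ)
  have hS : ∀ u w, (inner ℝ (S u) w : ℝ) = inner ℝ u (S w) :=
    inner_contOp_comm _ fun x u w => by simp [inner_smul_left, inner_smul_right]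
  have hg : ∀ u, (inner ℝ u g : ℝ) = inner ℝ (J u) b + inner ℝ o (H u) := by
    intro u
    rw [inner_toL2_right _ hgs.continuous, L2.inner_def (J u), L2.inner_def o,
      ← integral_add (L2.integrable_inner _ _) (L2.integrable_inner _ _)]
    refine integral_congr_ae ?_
    filter_upwards [coeFn_contOp hω.jacL.continuous u, coeFn_contOp hβs.jacL.continuous u,
      coeFn_toL2 hβs.continuous, coeFn_toL2 hω.continuous] with x h1 h2 h3 h4
    rw [inner_grad_inner hω hβs, h1, h2, h3, h4]
  have hp : p = H b + S b := by
    rw [hHb, hSb]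
    have : divTensor β = fun x => jacL β x (β x) + dvg β x • β x := funext (divTensor_eq hβs)
    refine Lp.ext ?_
    filter_upwards [coeFn_toL2 (this ▸ c4.add c5 : Continuous (divTensor β)), coeFn_toL2 c4,
      coeFn_toL2 c5, Lp.coeFn_add (toL2 fun x => jacL β x (β x))
        (toL2 fun x => dvg β x • β x)] with x h1 h2 h3 h4
    rw [h1, h4, Pi.add_apply, h2, h3, divTensor_eq hβs]
  have z1 : (inner ℝ B (H o - J b - S o) : ℝ) = 0 := by
    rw [hHo, hJb, hSo, ← toL2_sub c1 c2, 
      ← toL2_sub (f := fun x => jacL β x (ω x) - jacL ω x (β x)) (c1.sub c2) c3]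
    exact hB.inner_commutator hβs hω hsol
  have z2 : ∀ u ∈ Sol d, (inner ℝ u (H b) : ℝ) = 0 := by
    intro u hu
    rw [hHb, hβ]
    exact sol_inner_jacL_grad hu hψ
  have key := relative_energy_identity J H S hH hS hg hp z1 (z2 v hv) (z2 o hsol)
  have hw : v - o ∈ Sol d := (Sol d).sub_mem hv hsol
  have hη := toReal_K_sub_toL2 hK hω
  have hP := norm_sq_le_two_mul_K (m := m) hw ((K_sub_toL2_ne_top_iff v hω).2 hK)
  have hJD : -(L * ‖B - b‖ ^ 2) ≤ inner ℝ (J (B - b)) (B - b) := by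
    have h1 := (abs_le.1 (abs_real_inner_le_norm (J (B - b)) (B - b))).1
    have h2 := mul_le_mul_of_nonneg_right
      (norm_contOp_le hω.jacL.continuous (norm_jacL_apply_le hω hωL) (B - b)) (norm_nonneg (B - b))
    nlinarith
  have hSD : -(d * L * ‖B - b‖ * ‖v - o‖) ≤ inner ℝ (S (B - b)) (v - o) := by
    have h1 := (abs_le.1 (abs_real_inner_le_norm (S (B - b)) (v - o))).1
    have h3 : ∀ x u, ‖(dvg β x • ContinuousLinearMap.id ℝ (Vec d)) u‖ ≤ (d * L : ℝ) * ‖u‖ := by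
      intro x u
      simp only [smul_apply, ContinuousLinearMap.id_apply, norm_smul]
      exact mul_le_mul_of_nonneg_right (abs_dvg_le hβs hβL x) (norm_nonneg u)
    have h2 := mul_le_mul_of_nonneg_right (norm_contOp_le cS h3 (B - b)) (norm_nonneg (v - o))
    linarith
  rw [hsum, ← inner_contOp hω.jacL.continuous, ← inner_contOp cS, inner_add_left,
    inner_leray_of_mem_sol hw, inner_add_right, inner_sub_left (y := b) (z := toL2 β')]
  -- The weights are chosen so that the velocity part is `½‖v - o‖²`, which `hP` bounds by one copy
  -- of `K[v - o]`. Of the two copies produced by `hη`, the other one is the relative entropy kept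
  -- on the left.
  have hyoung : 2 * (d * L * ‖B - b‖ * ‖v - o‖) ≤
      2 * (d * L) ^ 2 * ‖B - b‖ ^ 2 + 1 / 2 * ‖v - o‖ ^ 2 := by
    nlinarith [sq_nonneg (2 * (d * L * ‖B - b‖) - ‖v - o‖)]
  linarith

end Pointwise

/-! ### Weighted evolution of `((B,β))` and `‖β‖²`, and bounds on the solution. -/

section TimeIntegration

variable {d m : ℕ} {T : ℝ}

theorem tderiv_dvg (hT : 0 < T) {β : ℝ → UnitAddTorus (Fin d) → Vec d} (hβ : IsSmoothOn T β)
    {t : ℝ} (ht : t ∈ Icc 0 T) (x : UnitAddTorus (Fin d)) :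
    tderiv T (fun s => dvg (β s)) t x = dvg (tderiv T β t) x := by
  refine tderiv_eq_of_hasDerivWithinAt hT ht (HasDerivWithinAt.fun_sum fun j _ => ?_)
  have h := (hβ.pderiv hT j).hasDerivWithinAt hT ht x
  rw [tderiv_pderiv hT hβ j ht] at h
  exact (EuclideanSpace.proj (𝕜 := ℝ) j : Vec d →L[ℝ] ℝ).hasFDerivAt.comp_hasDerivWithinAt t h

theorem tderiv_exp_mul (hT : 0 < T) {f : ℝ → UnitAddTorus (Fin d) → ℝ} (hf : IsSmoothOn T f)
    (r : ℝ) {t : ℝ} (ht : t ∈ Icc 0 T) (x : UnitAddTorus (Fin d)) :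
    tderiv T (fun s y => Real.exp (-(s * r)) * f s y) t x =
      Real.exp (-(t * r)) * (tderiv T f t x - r * f t x) := by
  have h1 : HasDerivWithinAt (fun s : ℝ => Real.exp (-(s * r)))
      (Real.exp (-(t * r)) * (-(1 * r))) (Icc 0 T) t :=
    (((hasDerivAt_id t).mul_const r).neg.exp).hasDerivWithinAt
  rw [tderiv_eq_of_hasDerivWithinAt hT ht (h1.mul (hf.hasDerivWithinAt hT ht x))]
  ring

theorem isSmoothOn_exp_mul {f : ℝ → UnitAddTorus (Fin d) → ℝ} (hf : IsSmoothOn T f)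
    (r : ℝ) : IsSmoothOn T (fun s y => Real.exp (-(s * r)) * f s y) :=
  (isSmoothOn_of_time (by fun_prop)).mul hf

theorem weighted_norm_sq_evolution (hT : 0 < T) {β : ℝ → UnitAddTorus (Fin d) → Vec d}
    (hβ : IsSmoothOn T β) (r : ℝ) {t : ℝ} (ht : t ∈ Icc 0 T) :
    Real.exp (-(t * r)) * ‖toL2 (β t)‖ ^ 2 - ‖toL2 (β 0)‖ ^ 2 =
      ∫ s in (0 : ℝ)..t, (2 * inner ℝ (toL2 (β s)) (toL2 (tderiv T β s))
        - r * ‖toL2 (β s)‖ ^ 2) * Real.exp (-(s * r)) := by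
  have hin := hβ.inner hβ
  have hn : ∀ s ∈ Icc 0 T, ‖toL2 (β s)‖ ^ 2 = ∫ x, (inner ℝ (β s x) (β s x) : ℝ) := by
    intro s hs
    rw [← real_inner_self_eq_norm_sq, inner_toL2_left _ (hβ.isSmooth hs).continuous]
    refine integral_congr_ae ?_
    filter_upwards [coeFn_toL2 (hβ.isSmooth hs).continuous] with x hx
    rw [hx]
  have h := integral_sub_eq_integral_tderiv hT (isSmoothOn_exp_mul hin r) ht
  simp only [integral_const_mul] at h
  rw [hn t ht, hn 0 ⟨le_rfl, hT.le⟩]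
  simp only [zero_mul, neg_zero, Real.exp_zero, one_mul] at h
  rw [h]
  refine intervalIntegral.integral_congr fun s hs => ?_
  rw [uIcc_of_le ht.1] at hs
  have hs' : s ∈ Icc 0 T := ⟨hs.1, hs.2.trans ht.2⟩
  have hd : ∀ x, tderiv T (fun s y => (inner ℝ (β s y) (β s y) : ℝ)) s x =
      2 * inner ℝ (β s x) (tderiv T β s x) := by
    intro x
    have h1 := hβ.hasDerivWithinAt hT hs' x
    rw [tderiv_eq_of_hasDerivWithinAt hT hs' (h1.inner ℝ h1), real_inner_comm]
    ring
  have hin' : (inner ℝ (toL2 (β s)) (toL2 (tderiv T β s)) : ℝ) =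
      ∫ x, (inner ℝ (β s x) (tderiv T β s x) : ℝ) := by
    rw [inner_toL2_left _ (hβ.isSmooth hs').continuous]
    refine integral_congr_ae ?_
    filter_upwards [coeFn_toL2 ((hβ.tderiv hT).isSmooth hs').continuous] with x hx
    rw [hx]
  simp only [tderiv_exp_mul hT hin r hs', integral_const_mul, hd]
  rw [integral_sub, integral_const_mul, integral_const_mul, hin', hn s hs', mul_comm]
  · exact (integrable_of_continuous
      ((hβ.isSmooth hs').inner ((hβ.tderiv hT).isSmooth hs')).continuous).const_mul _
  · exact (integrable_of_continuous (hin.isSmooth hs').continuous).const_mul _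

theorem IsDissipativeSolution.weighted_inner_evolution (hT : 0 < T) {φ : ℝ → L2Scalar d}
    {B v : ℝ → L2Field d} (h : IsDissipativeSolution m T φ B v)
    {β : ℝ → UnitAddTorus (Fin d) → Vec d} (hβ : IsSmoothOn T β) (r : ℝ) {t : ℝ}
    (ht : t ∈ Icc 0 T) :
    Real.exp (-(t * r)) * inner ℝ (B t) (toL2 (β t)) - inner ℝ (B 0) (toL2 (β 0)) =
      ∫ s in (0 : ℝ)..t, (inner ℝ (B s) (toL2 (tderiv T β s))
        + (∫ x, (inner ℝ ((dvg (β s) x • ContinuousLinearMap.id ℝ (Vec d)) (B s x)) (v s x) : ℝ))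
        - r * inner ℝ (B s) (toL2 (β s))) * Real.exp (-(s * r)) := by
  have hdv := hβ.dvg hT
  have hζ := isSmoothOn_exp_mul hdv r
  -- The test function is `e^{-sr} div β`: integrating by parts in space turns `∫ φ div β` into
  -- `-((B,β))`.
  have htr := h.transport _ hζ t ht
  have h0 : (0 : ℝ) ∈ Icc 0 T := ⟨le_rfl, hT.le⟩
  have e : ∀ s ∈ Icc 0 T, ∫ x, φ s x * (Real.exp (-(s * r)) * dvg (β s) x) =
      -(Real.exp (-(s * r)) * inner ℝ (B s) (toL2 (β s))) := by
    intro s hs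
    rw [(h.weak_grad s hs).inner_toL2 (hβ.isSmooth hs), mul_neg, neg_neg, ← integral_const_mul]
    congr 1; funext x; ring
  rw [e t ht, e 0 h0] at htr
  simp only [zero_mul, neg_zero, Real.exp_zero, one_mul] at htr
  -- The identity holds only for almost every time, since `v s` is known to be in `Sol d` only then;
  -- that membership is what moves the gradient from the test function to `φ`.
  have hae : ∀ᵐ s, s ∈ uIoc 0 t →
      ∫ x, φ s x * (tderiv T (fun s x => Real.exp (-(s * r)) * dvg (β s) x) s x +
        inner ℝ (v s x) (grad (fun x => Real.exp (-(s * r)) * dvg (β s) x) x)) =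
      -((inner ℝ (B s) (toL2 (tderiv T β s))
        + (∫ x, (inner ℝ ((dvg (β s) x • ContinuousLinearMap.id ℝ (Vec d)) (B s x)) (v s x) : ℝ))
        - r * inner ℝ (B s) (toL2 (β s))) * Real.exp (-(s * r))) := by
    have hsol := (ae_restrict_iff' measurableSet_Icc).1 h.mem_sol
    filter_upwards [hsol] with s hs1 hs
    rw [uIoc_of_le ht.1] at hs
    have hs' : s ∈ Icc 0 T := ⟨hs.1.le, hs.2.trans ht.2⟩
    have hvs := hs1 hs'
    have hζs := hζ.isSmooth hs'
    have hβ's := (hβ.tderiv hT).isSmooth hs'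
    have i0 : ∀ f : UnitAddTorus (Fin d) → ℝ, Continuous f →
        Integrable fun x => φ s x * f x := fun f hf =>
      (MemLp.mul_continuous (Lp.memLp (φ s)) hf).integrable (by norm_num)
    have i2 : Integrable fun x => φ s x *
        (inner ℝ (v s x) (grad (fun x => Real.exp (-(s * r)) * dvg (β s) x) x) : ℝ) := by
      refine (Lp.memLp (φ s)).integrable_mul (q := 2) ?_
      simp only [inner_vec_eq_sum]
      exact memLp_finsetSum _ fun j _ =>
        MemLp.mul_continuous (memLp_coord (v s) j) (hζs.pderiv j).continuous
    have i1 : Integrable fun x => φ s x *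
        tderiv T (fun s x => Real.exp (-(s * r)) * dvg (β s) x) s x :=
      i0 _ ((hζ.tderiv hT).isSmooth hs').continuous
    simp only [mul_add]
    rw [integral_add i1 i2, integral_mul_inner_grad_of_mem_sol (h.weak_grad s hs') hvs hζs]
    simp only [tderiv_exp_mul hT hdv r hs', tderiv_dvg hT hβ hs']
    rw [(h.weak_grad s hs').inner_toL2 hβ's, (h.weak_grad s hs').inner_toL2 (hβ.isSmooth hs')]
    have e1 : ∫ x, φ s x * (Real.exp (-(s * r)) * (dvg (tderiv T β s) x - r * dvg (β s) x)) =
        Real.exp (-(s * r)) * ((∫ x, φ s x * dvg (tderiv T β s) x) -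
          r * ∫ x, φ s x * dvg (β s) x) := by
      rw [← integral_const_mul, ← integral_sub, ← integral_const_mul]
      · congr 1; funext x; ring
      · exact i0 _ hβ's.dvg.continuous
      · exact (i0 _ (hβ.isSmooth hs').dvg.continuous).const_mul r
    have e2 : ∫ x, Real.exp (-(s * r)) * dvg (β s) x * (inner ℝ (v s x) (B s x) : ℝ) =
        Real.exp (-(s * r)) * ∫ x, (inner ℝ ((dvg (β s) x •
          ContinuousLinearMap.id ℝ (Vec d)) (B s x)) (v s x) : ℝ) := by
      rw [← integral_const_mul]
      congr 1; funext x
      simp only [smul_apply, ContinuousLinearMap.id_apply, inner_smul_left,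
        real_inner_comm (B s x)]
      simp
      ring
    rw [e1, e2]
    ring
  rw [intervalIntegral.integral_congr_ae hae, intervalIntegral.integral_neg] at htr
  linarith

theorem IsSmoothOn.pderivs {F : Type*} [NormedAddCommGroup F] [NormedSpace ℝ F] (hT : 0 < T)
    {f : ℝ → UnitAddTorus (Fin d) → F} (hf : IsSmoothOn T f) {k : ℕ} (I : Fin k → Fin d) :
    IsSmoothOn T (fun t => GFTorus.pderivs I (f t)) := by
  induction k with
  | zero => simpa only [pderivs_zero] using hf
  | succ k ih => simpa only [pderivs_succ] using (ih (Fin.tail I)).pderiv hT (I 0)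

theorem IsSmoothOn.negLapPow {F : Type*} [NormedAddCommGroup F] [NormedSpace ℝ F] (hT : 0 < T)
    {f : ℝ → UnitAddTorus (Fin d) → F} (hf : IsSmoothOn T f) (m : ℕ) :
    IsSmoothOn T (fun t => GFTorus.negLapPow m (f t)) := by
  have h : IsSmoothOn T (fun t x => (-1 : ℝ) ^ m •
      ∑ I : Fin m → Fin d, GFTorus.pderivs I (GFTorus.pderivs I (f t)) x) :=
    (IsSmoothOn.sum (s := Finset.univ) fun I _ => (hf.pderivs hT I).pderivs hT I).clm
      ((-1 : ℝ) ^ m • ContinuousLinearMap.id ℝ F)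
  exact h.congr fun t ht => negLapPow_eq_sum (hf.isSmooth ht) m

theorem integrableOn_K_toL2 (hT : 0 < T) {ω : ℝ → UnitAddTorus (Fin d) → Vec d}
    (hω : IsSmoothOn T ω) : IntegrableOn (fun s => (K m (toL2 (ω s))).toReal) (Icc 0 T) := by
  have h : ∀ I : Fin m → Fin d,
      IntegrableOn (fun s => ‖toL2 (pderivs I (ω s))‖ ^ 2) (Icc 0 T) := by
    intro I
    obtain ⟨c, hc, -, hcf⟩ := exists_continuous_toL2 hT.le (hω.pderivs hT I)
    refine IntegrableOn.congr_fun (f := fun s => ‖c s‖ ^ 2) ?_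
      (fun s hs => by simp only [hcf s hs]) measurableSet_Icc
    exact (hc.norm.pow 2).continuousOn.integrableOn_Icc
  refine IntegrableOn.congr_fun
    (f := fun s => 1 / 2 * ∑ I : Fin m → Fin d, ‖toL2 (pderivs I (ω s))‖ ^ 2) ?_
    (fun s hs => ?_) measurableSet_Icc
  · exact (integrable_finsetSum _ fun I _ => h I).const_mul _
  · simp only
    rw [K_toL2 (hω.isSmooth hs), ENNReal.toReal_ofReal (by positivity)]

/-- The dissipation inequality with `z = 0` and `r = 0`, all terms but the last one on the left
being dropped. The uniform bound is used for integrability in time. -/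
theorem IsDissipativeSolution.norm_le {φ : ℝ → L2Scalar d}
    {B v : ℝ → L2Field d} (h : IsDissipativeSolution m T φ B v) {t : ℝ} (ht : t ∈ Icc 0 T) :
    ‖B t‖ ≤ ‖B 0‖ := by
  have hz : IsSmooth (fun _ : UnitAddTorus (Fin d) => (0 : Vec d)) := IsSmooth.const 0
  have hlip : SpaceLipschitz 0 (fun _ : UnitAddTorus (Fin d) => (0 : Vec d)) :=
    LipschitzWith.const 0
  have hd := h.dissipation (fun _ _ => 0) (IsSmoothOn.const 0)
    (fun t _ => by rw [toL2_zero]; exact (Sol d).zero_mem) 0 le_rfl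
    (fun t _ x => symMatrix_posSemidef hz hlip (by simp) x) t ht
  have hK0 : K m (toL2 fun _ : UnitAddTorus (Fin d) => (0 : Vec d)) = 0 := by
    have hw : IsWeakDerivs m (0 : L2Field d) fun _ => 0 := by
      rw [isWeakDerivs_iff_inner]; simp
    rw [toL2_zero, hw.K_eq]
    simp
  simp only [hK0, mul_zero, zero_mul, lintegral_zero, add_zero, neg_zero, Real.exp_zero,
    mul_one] at hd
  have h2 := (ENNReal.ofReal_le_ofReal_iff (sq_nonneg _)).1 (le_trans le_add_self hd)
  exact (pow_le_pow_iff_left₀ (norm_nonneg _) (norm_nonneg _) two_ne_zero).1 h2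

theorem IsDissipativeSolution.aestronglyMeasurable (hT : 0 < T) {φ : ℝ → L2Scalar d}
    {B v : ℝ → L2Field d} (h : IsDissipativeSolution m T φ B v) :
    AEStronglyMeasurable B (volume.restrict (Icc 0 T)) :=
  aestronglyMeasurable_of_continuousOn_inner hT.le h.weak_cont

theorem IsDissipativeSolution.integrableOn (hT : 0 < T) {φ : ℝ → L2Scalar d}
    {B v : ℝ → L2Field d} (h : IsDissipativeSolution m T φ B v) :
    IntegrableOn B (Icc 0 T) :=
  Integrable.of_bound (h.aestronglyMeasurable hT) ‖B 0‖
    ((ae_restrict_iff' measurableSet_Icc).2 (.of_forall fun _ ht => h.norm_le ht))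

theorem IsDissipativeSolution.integrableOn_norm_sq (hT : 0 < T) {φ : ℝ → L2Scalar d}
    {B v : ℝ → L2Field d} (h : IsDissipativeSolution m T φ B v) :
    IntegrableOn (fun s => ‖B s‖ ^ 2) (Icc 0 T) :=
  Integrable.of_bound ((h.aestronglyMeasurable hT).norm.pow 2) (‖B 0‖ ^ 2)
    ((ae_restrict_iff' measurableSet_Icc).2 (.of_forall fun t ht => by
      rw [Real.norm_of_nonneg (sq_nonneg _)]
      exact pow_le_pow_left₀ (norm_nonneg _) (h.norm_le ht) 2))

end TimeIntegration

/-! ### The dissipation inequality in real form and the integrated entropy estimate. -/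

section Estimate

variable {d m : ℕ} {T : ℝ}

theorem IsDissipativeSolution.integrableOn_quadratic (hT : 0 < T) {φ : ℝ → L2Scalar d}
    {B v : ℝ → L2Field d} (h : IsDissipativeSolution m T φ B v)
    {ω : ℝ → UnitAddTorus (Fin d) → Vec d} (hω : IsSmoothOn T ω) :
    IntegrableOn (fun s => ∫ x, (inner ℝ (jacL (ω s) x (B s x)) (B s x) : ℝ)) (Icc 0 T) :=
  integrableOn_integral_inner_clm hT.le (hω.jacL hT) (h.aestronglyMeasurable hT)
    (fun _ ht => h.norm_le ht) (h.integrableOn hT)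

/-- The dissipation inequality, in terms of real integrals. -/
theorem IsDissipativeSolution.dissipation_real (hT : 0 < T) {φ : ℝ → L2Scalar d}
    {B v : ℝ → L2Field d} (h : IsDissipativeSolution m T φ B v)
    {ω : ℝ → UnitAddTorus (Fin d) → Vec d} (hω : IsSmoothOn T ω)
    (hsol : ∀ t ∈ Icc 0 T, toL2 (ω t) ∈ Sol d) {L : ℝ≥0}
    (hL : ∀ t ∈ Icc 0 T, SpaceLipschitz L (ω t)) {r : ℝ} (hr : 2 * L ≤ r) :
    (∀ᵐ s ∂(volume.restrict (Icc 0 T)), K m (v s) ≠ ⊤) ∧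
      IntegrableOn (fun s => (K m (v s)).toReal) (Icc 0 T) ∧
      ∀ t ∈ Icc 0 T,
        (∫ s in (0 : ℝ)..t, (2 * (K m (v s)).toReal - 2 * (K m (toL2 (ω s))).toReal
          + r * ‖B s‖ ^ 2 + 2 * (∫ x, (inner ℝ (jacL (ω s) x (B s x)) (B s x) : ℝ)))
            * Real.exp (-(s * r))) + ‖B t‖ ^ 2 * Real.exp (-(t * r)) ≤ ‖B 0‖ ^ 2 := by
  borelize (L2Field d)
  have hr0 : 0 ≤ r := le_trans (by positivity) hr
  set e : ℝ → ℝ := fun s => Real.exp (-(s * r))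
  have he : Continuous e := by fun_prop
  have hepos : ∀ s, 0 < e s := fun s => Real.exp_pos _
  set Q : ℝ → ℝ := fun s =>
    r * ‖B s‖ ^ 2 + 2 * (∫ x, (inner ℝ (jacL (ω s) x (B s x)) (B s x) : ℝ))
  have hQi : IntegrableOn Q (Icc 0 T) :=
    ((h.integrableOn_norm_sq hT).const_mul r).add ((h.integrableOn_quadratic hT hω).const_mul 2)
  have hQx : ∀ s ∈ Icc 0 T, 0 ≤ Q s ∧ ∫⁻ x, ENNReal.ofReal
      (∑ i, ∑ j, B s x i * B s x j * symMatrix r (ω s) x i j) = ENNReal.ofReal (Q s) := by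
    intro s hs
    have hωs := hω.isSmooth hs
    have i1 := L2.integrable_inner (𝕜 := ℝ) (B s) (B s)
    have i2 := integrable_inner_clm hωs.jacL.continuous (B s) (B s)
    have hQ : Q s = ∫ x, (r * (inner ℝ (B s x) (B s x) : ℝ) +
        2 * inner ℝ (jacL (ω s) x (B s x)) (B s x)) := by
      rw [integral_add (i1.const_mul r) (i2.const_mul 2), integral_const_mul, integral_const_mul,
        ← L2.inner_def, real_inner_self_eq_norm_sq]
    have hnn : ∀ x, 0 ≤ r * (inner ℝ (B s x) (B s x) : ℝ) +
        2 * inner ℝ (jacL (ω s) x (B s x)) (B s x) := fun x =>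
      quadraticForm_nonneg hωs (hL s hs) hr x _
    refine ⟨by rw [hQ]; exact integral_nonneg hnn, ?_⟩
    simp only [sum_mul_symMatrix hωs]
    rw [hQ]
    exact (ofReal_integral_eq_lintegral_ofReal ((i1.const_mul r).add (i2.const_mul 2))
      (.of_forall hnn)).symm
  set F : ℝ → ℝ≥0∞ := fun s => (2 * K m (v s) + ENNReal.ofReal (Q s)) * ENNReal.ofReal (e s)
  have hFm : AEMeasurable F (volume.restrict (Icc 0 T)) :=
    ((((measurable_K m).comp_aemeasurable h.memLp.1.aemeasurable).const_mul 2).add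
      hQi.1.aemeasurable.ennreal_ofReal).mul he.measurable.aemeasurable.ennreal_ofReal
  set g : ℝ → ℝ := fun s => 2 * (K m (toL2 (ω s))).toReal * e s
  have hgi : IntegrableOn g (Icc 0 T) :=
    IntegrableOn.mul_continuousOn ((integrableOn_K_toL2 hT hω).const_mul 2) he.continuousOn
      isCompact_Icc
  have hg0 : ∀ s, 0 ≤ g s := fun s =>
    mul_nonneg (mul_nonneg two_pos.le ENNReal.toReal_nonneg) (hepos s).le
  have hdis : ∀ t ∈ Icc 0 T, (∫⁻ s in Icc 0 t, F s) + ENNReal.ofReal (‖B t‖ ^ 2 * e t) ≤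
      ENNReal.ofReal (‖B 0‖ ^ 2 + ∫ s in Icc 0 t, g s) := by
    intro t ht
    have hsub : Icc 0 t ⊆ Icc 0 T := Icc_subset_Icc_right ht.2
    have hd := h.dissipation ω hω hsol r hr0
      (fun t ht x => symMatrix_posSemidef (hω.isSmooth ht) (hL t ht) hr x) t ht
    have e1 : ∫⁻ s in Icc 0 t, F s = ∫⁻ s in Icc 0 t, (2 * K m (v s) + ∫⁻ x, ENNReal.ofReal
            (∑ i, ∑ j, B s x i * B s x j * symMatrix r (ω s) x i j)) *
          ENNReal.ofReal (Real.exp (-(s * r))) :=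
      setLIntegral_congr_fun measurableSet_Icc fun s hs => by simp only [(hQx s (hsub hs)).2, F, e]
    have e2 : ∫⁻ s in Icc 0 t, 2 * K m (toL2 (ω s)) * ENNReal.ofReal (Real.exp (-(s * r))) =
        ENNReal.ofReal (∫ s in Icc 0 t, g s) := by
      rw [ofReal_integral_eq_lintegral_ofReal (hgi.mono_set hsub) (.of_forall hg0)]
      refine setLIntegral_congr_fun measurableSet_Icc fun s hs => ?_
      have hfin : K m (toL2 (ω s)) ≠ ⊤ := by
        rw [K_toL2 (hω.isSmooth (hsub hs))]; exact ENNReal.ofReal_ne_top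
      simp only [g]
      rw [ENNReal.ofReal_mul (mul_nonneg two_pos.le ENNReal.toReal_nonneg),
        ENNReal.ofReal_mul two_pos.le, ENNReal.ofReal_toReal hfin, ENNReal.ofReal_ofNat]
    rw [ENNReal.ofReal_add (sq_nonneg _) (setIntegral_nonneg measurableSet_Icc fun s _ => hg0 s),
      e1, ← e2]
    exact hd
  -- The right-hand side is finite because `ω` is smooth, so the inequality at the final time `T`
  -- forces `K m (v s)` to be finite almost everywhere.
  have hFfin : ∫⁻ s in Icc 0 T, F s ≠ ⊤ :=
    ne_top_of_le_ne_top ENNReal.ofReal_ne_top (le_self_add.trans (hdis T ⟨hT.le, le_rfl⟩))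
  have hKfin : ∀ᵐ s ∂(volume.restrict (Icc 0 T)), K m (v s) ≠ ⊤ := by
    filter_upwards [ae_lt_top' hFm hFfin] with s hs hK
    simp only [F, hK] at hs
    rw [ENNReal.mul_top (by norm_num), top_add,
      ENNReal.top_mul (by simpa using hepos s)] at hs
    exact lt_irrefl _ hs
  set f : ℝ → ℝ := fun s => (2 * (K m (v s)).toReal + Q s) * e s
  have hFf : ∀ᵐ s ∂(volume.restrict (Icc 0 T)), F s = ENNReal.ofReal (f s) ∧ 0 ≤ f s := by
    filter_upwards [hKfin, ae_restrict_mem measurableSet_Icc] with s hs hsT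
    have hQ0 := (hQx s hsT).1
    have h2 : (0 : ℝ) ≤ 2 * (K m (v s)).toReal := mul_nonneg two_pos.le ENNReal.toReal_nonneg
    refine ⟨?_, mul_nonneg (add_nonneg h2 hQ0) (hepos s).le⟩
    simp only [F, f]
    rw [ENNReal.ofReal_mul (add_nonneg h2 hQ0), ENNReal.ofReal_add h2 hQ0,
      ENNReal.ofReal_mul two_pos.le, ENNReal.ofReal_toReal hs, ENNReal.ofReal_ofNat]
  have hfi : IntegrableOn f (Icc 0 T) := by
    refine (integrable_toReal_of_lintegral_ne_top hFm hFfin).congr ?_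
    filter_upwards [hFf] with s hs
    rw [hs.1, ENNReal.toReal_ofReal hs.2]
  -- `K` is recovered from the integrable `f` by removing the exponential weight, subtracting `Q`
  -- and halving.
  have hKi : IntegrableOn (fun s => (K m (v s)).toReal) (Icc 0 T) := by
    have h1 : IntegrableOn (fun s => f s * Real.exp (s * r)) (Icc 0 T) :=
      hfi.mul_continuousOn (by fun_prop) isCompact_Icc
    refine ((h1.sub hQi).const_mul (1 / 2)).congr (.of_forall fun s => ?_)
    simp only [f, e, Pi.sub_apply, mul_assoc, ← Real.exp_add]
    rw [neg_add_cancel, Real.exp_zero]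
    ring
  refine ⟨hKfin, hKi, fun t ht => ?_⟩
  have hsub : Icc 0 t ⊆ Icc 0 T := Icc_subset_Icc_right ht.2
  have hFt : ∫⁻ s in Icc 0 t, F s = ENNReal.ofReal (∫ s in Icc 0 t, f s) := by
    have hr' := ae_restrict_of_ae_restrict_of_subset hsub hFf
    rw [ofReal_integral_eq_lintegral_ofReal (hfi.mono_set hsub) (hr'.mono fun s hs => hs.2)]
    exact lintegral_congr_ae (hr'.mono fun s hs => hs.1)
  have hf0 : 0 ≤ ∫ s in Icc 0 t, f s :=
    integral_nonneg_of_ae ((ae_restrict_of_ae_restrict_of_subset hsub hFf).mono fun s hs => hs.2)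
  have hfin := hdis t ht
  rw [hFt, ← ENNReal.ofReal_add hf0 (mul_nonneg (sq_nonneg _) (hepos t).le),
    ENNReal.ofReal_le_ofReal_iff
      (add_nonneg (sq_nonneg _) (setIntegral_nonneg measurableSet_Icc fun s _ => hg0 s))] at hfin
  have e3 : ∫ s in (0 : ℝ)..t, (2 * (K m (v s)).toReal - 2 * (K m (toL2 (ω s))).toReal
          + r * ‖B s‖ ^ 2 + 2 * (∫ x, (inner ℝ (jacL (ω s) x (B s x)) (B s x) : ℝ)))
            * Real.exp (-(s * r)) = (∫ s in Icc 0 t, f s) - ∫ s in Icc 0 t, g s := by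
    rw [intervalIntegral.integral_of_le ht.1, ← integral_Icc_eq_integral_Ioc,
      ← integral_sub (hfi.mono_set hsub) (hgi.mono_set hsub)]
    congr 1
    funext s
    simp only [f, g, Q, e]
    ring
  rw [e3]
  linarith

theorem IsDissipativeSolution.integrableOn_velocity {φ : ℝ → L2Scalar d}
    {B v : ℝ → L2Field d} (h : IsDissipativeSolution m T φ B v) : IntegrableOn v (Icc 0 T) :=
  h.memLp.integrable (by norm_num)

theorem isSmoothOn_divTensor (hT : 0 < T) {β : ℝ → UnitAddTorus (Fin d) → Vec d}
    (hβ : IsSmoothOn T β) : IsSmoothOn T (fun t => divTensor (β t)) :=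
  isSmoothOn_vec fun i => IsSmoothOn.sum (s := Finset.univ)
    (f := fun j t => pderiv j (fun y => β t y i * β t y j))
    fun j _ => ((hβ.coord i).mul (hβ.coord j)).pderiv hT j

/-- For almost every time `v - ω` lies in `Sol d`, so the projection can be dropped from the inner
product; the regularity in time of the projected field never enters. -/
theorem IsDissipativeSolution.integrableOn_linTerm (hT : 0 < T) {φ : ℝ → L2Scalar d}
    {B v : ℝ → L2Field d} (h : IsDissipativeSolution m T φ B v)
    {β ω : ℝ → UnitAddTorus (Fin d) → Vec d} (hβ : IsSmoothOn T β) (hω : IsSmoothOn T ω)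
    (hsol : ∀ t ∈ Icc 0 T, toL2 (ω t) ∈ Sol d) :
    IntegrableOn (linTerm m T B v β ω) (Icc 0 T) := by
  have hv := h.integrableOn_velocity
  have i1 : IntegrableOn (fun t => (inner ℝ (B t - toL2 (β t)) (toL2 fun x =>
      grad (fun y => inner ℝ (ω t y) (β t y)) x + tderiv T β t x) : ℝ)) (Icc 0 T) :=
    integrableOn_inner_toL2 hT.le (((hω.inner hβ).grad hT).add (hβ.tderiv hT))
      ((h.integrableOn hT).sub (integrableOn_toL2 hT.le hβ))
  have hw : IntegrableOn (fun t => v t - toL2 (ω t)) (Icc 0 T) :=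
    hv.sub (integrableOn_toL2 hT.le hω)
  have i2 := integrableOn_inner_toL2 hT.le (isSmoothOn_divTensor hT hβ) hw
  have i3 := integrableOn_inner_toL2 hT.le (hω.negLapPow hT m) hw
  refine (i1.neg.sub (i2.add i3)).congr ?_
  filter_upwards [h.mem_sol, ae_restrict_mem measurableSet_Icc] with t ht htT
  simp only [linTerm, Pi.sub_apply, Pi.neg_apply, Pi.add_apply]
  rw [inner_add_left, inner_leray_of_mem_sol ((Sol d).sub_mem ht (hsol t htT)), K',
    real_inner_comm (v t - toL2 (ω t)), real_inner_comm (v t - toL2 (ω t))]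

theorem toReal_relEntropy (a : L2Field d) {b : UnitAddTorus (Fin d) → Vec d} (hb : IsSmooth b) :
    (relEntropy m a b).toReal = (K m (a - toL2 b)).toReal := by
  rw [relEntropy_eq a hb, EReal.toReal_coe_ennreal]

theorem IsDissipativeSolution.relative_entropy_inequality (hT : 0 < T) {φ : ℝ → L2Scalar d}
    {B v : ℝ → L2Field d} (h : IsDissipativeSolution m T φ B v)
    {ψ : ℝ → UnitAddTorus (Fin d) → ℝ} {β ω : ℝ → UnitAddTorus (Fin d) → Vec d}
    (hψ : IsSmoothOn T ψ) (hω : IsSmoothOn T ω) (hβψ : ∀ t ∈ Icc 0 T, β t = grad (ψ t))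
    (hsol : ∀ t ∈ Icc 0 T, toL2 (ω t) ∈ Sol d) {L : ℝ≥0}
    (hL : ∀ t ∈ Icc 0 T, SpaceLipschitz L (β t) ∧ SpaceLipschitz L (ω t)) :
    (∀ᵐ s ∂(volume.restrict (Icc 0 T)), K m (v s - toL2 (ω s)) ≠ ⊤) ∧
      IntegrableOn (fun s => (relEntropy m (v s) (ω s)).toReal) (Icc 0 T) ∧
      ∀ t ∈ Icc 0 T,
        ‖B t - toL2 (β t)‖ ^ 2 +
            ∫ s in (0 : ℝ)..t, Real.exp ((t - s) * (2 * L + 2 * (d * L) ^ 2)) *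
              ((relEntropy m (v s) (ω s)).toReal - 2 * linTerm m T B v β ω s) ≤
          ‖B 0 - toL2 (β 0)‖ ^ 2 * Real.exp (t * (2 * L + 2 * (d * L) ^ 2)) := by
  have hβ : IsSmoothOn T β := (hψ.grad hT).congr hβψ
  -- The exponent `r` of the dissipation inequality is taken equal to the constant of the fixed-time
  -- estimate, which is permitted because it is at least `2L`.
  set C : ℝ := 2 * L + 2 * (d * L) ^ 2
  have hC : 2 * (L : ℝ) ≤ C := le_add_of_nonneg_right (by positivity)
  obtain ⟨hKfin, hKi, hdis⟩ := h.dissipation_real hT hω hsol (fun t ht => (hL t ht).2) hC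
  have hfin : ∀ᵐ s ∂(volume.restrict (Icc 0 T)), K m (v s - toL2 (ω s)) ≠ ⊤ := by
    filter_upwards [hKfin, ae_restrict_mem measurableSet_Icc] with s hs hsT
    exact (K_sub_toL2_ne_top_iff _ (hω.isSmooth hsT)).2 hs
  have hv := h.integrableOn_velocity
  have hKωi := integrableOn_K_toL2 (m := m) hT hω
  have hηi : IntegrableOn (fun s => (relEntropy m (v s) (ω s)).toReal) (Icc 0 T) := by
    have i3 := integrableOn_inner_toL2 hT.le (hω.negLapPow hT m)
      (hv.sub (integrableOn_toL2 hT.le hω))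
    refine ((hKi.sub hKωi).sub i3).congr ?_
    filter_upwards [hKfin, ae_restrict_mem measurableSet_Icc] with s hs hsT
    rw [toReal_relEntropy _ (hω.isSmooth hsT), toReal_K_sub_toL2 hs (hω.isSmooth hsT)]
    simp only [Pi.sub_apply, K']
    rw [real_inner_comm]
  refine ⟨hfin, hηi, fun t ht => ?_⟩
  have hli := h.integrableOn_linTerm hT hβ hω hsol
  have hsub : Icc 0 t ⊆ Icc 0 T := Icc_subset_Icc_right ht.2
  have hii : ∀ {f : ℝ → ℝ}, IntegrableOn f (Icc 0 T) →
      IntervalIntegrable (fun s => f s * Real.exp (-(s * C))) volume 0 t := by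
    intro f hf
    rw [intervalIntegrable_iff_integrableOn_Icc_of_le ht.1]
    exact (hf.mono_set hsub).mul_continuousOn (by fun_prop) isCompact_Icc
  have hqi := h.integrableOn_quadratic hT hω
  have hBi := h.integrableOn_norm_sq hT
  have hSβ : IsSmoothOn T (fun s x => dvg (β s) x • ContinuousLinearMap.id ℝ (Vec d)) :=
    (hβ.dvg hT).clm ((ContinuousLinearMap.id ℝ ℝ).smulRight (ContinuousLinearMap.id ℝ (Vec d)))
  have hpi := integrableOn_integral_inner_clm hT.le hSβ (h.aestronglyMeasurable hT)
    (fun _ ht => h.norm_le ht) hv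
  have hb1 := integrableOn_inner_toL2 hT.le (hβ.tderiv hT) (h.integrableOn hT)
  have hb2 := integrableOn_inner_toL2 hT.le hβ (h.integrableOn hT)
  have hc1 := integrableOn_inner_toL2 hT.le (hβ.tderiv hT) (integrableOn_toL2 hT.le hβ)
  have hc2 : IntegrableOn (fun s => ‖toL2 (β s)‖ ^ 2) (Icc 0 T) := by
    simp only [← real_inner_self_eq_norm_sq]
    exact integrableOn_inner_toL2 hT.le hβ (integrableOn_toL2 hT.le hβ)
  have E1 := hdis t ht
  have E2 := h.weighted_inner_evolution hT hβ C ht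
  have E3 := weighted_norm_sq_evolution hT hβ C ht
  have I1 := hii ((((hKi.const_mul 2).sub (hKωi.const_mul 2)).add (hBi.const_mul C)).add
    (hqi.const_mul 2))
  have I2 := hii ((hb1.add hpi).sub (hb2.const_mul C))
  have I3 := hii ((hc1.const_mul 2).sub (hc2.const_mul C))
  have Iη := hii (hηi.sub (hli.const_mul 2))
  -- The combination `I1 + 2 I2 - I3` is the one produced by expanding `‖B - β‖²`; its terms with
  -- coefficient `C` add up to `C‖B - β‖²`, so the fixed-time estimate applies under the integral.
  have hmono := intervalIntegral.integral_mono_ae_restrict ht.1 Iη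
    ((I1.add (I2.const_mul 2)).sub I3) (by
      refine ae_restrict_of_ae_restrict_of_subset hsub ?_
      filter_upwards [hKfin, h.mem_sol, ae_restrict_mem measurableSet_Icc] with s hs hvs hsT
      have key := relative_entropy_estimate (h.weak_grad s hsT) hvs hs (hψ.isSmooth hsT)
        (hβψ s hsT) (hω.isSmooth hsT) (hsol s hsT) (hL s hsT).1 (hL s hsT).2
        ((hβ.tderiv hT).isSmooth hsT)
      have hD := norm_sub_sq_real (B s) (toL2 (β s))
      rw [hD, ← toReal_relEntropy _ (hω.isSmooth hsT)] at key
      simp only [Pi.sub_apply, Pi.add_apply, linTerm]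
      have := mul_le_mul_of_nonneg_right key (Real.exp_pos (-(s * C))).le
      refine this.trans_eq ?_
      simp only [C]
      ring)
  rw [intervalIntegral.integral_sub (I1.add (I2.const_mul 2)) I3,
    intervalIntegral.integral_add I1 (I2.const_mul 2), intervalIntegral.integral_const_mul] at hmono
  simp only [Pi.sub_apply, Pi.add_apply] at hmono
  have hDt := norm_sub_sq_real (B t) (toL2 (β t))
  have hD0 := norm_sub_sq_real (B 0) (toL2 (β 0))
  have hexp : Real.exp (t * C) * Real.exp (-(t * C)) = 1 := by
    rw [← Real.exp_add, add_neg_cancel, Real.exp_zero]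
  -- This is the estimate still carrying the decaying weight; multiplication by `e^{tC}` turns it
  -- into the stated form.
  have hfinal : (∫ s in (0 : ℝ)..t, ((relEntropy m (v s) (ω s)).toReal -
      2 * linTerm m T B v β ω s) * Real.exp (-(s * C))) +
      ‖B t - toL2 (β t)‖ ^ 2 * Real.exp (-(t * C)) ≤ ‖B 0 - toL2 (β 0)‖ ^ 2 := by
    rw [hDt, hD0]
    linarith
  have hint : ∫ s in (0 : ℝ)..t, Real.exp ((t - s) * C) *
      ((relEntropy m (v s) (ω s)).toReal - 2 * linTerm m T B v β ω s) =
      Real.exp (t * C) * ∫ s in (0 : ℝ)..t, ((relEntropy m (v s) (ω s)).toReal -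
        2 * linTerm m T B v β ω s) * Real.exp (-(s * C)) := by
    rw [← intervalIntegral.integral_const_mul]
    congr 1
    funext s
    rw [sub_mul, sub_eq_add_neg, Real.exp_add]
    ring
  rw [hint]
  have := mul_le_mul_of_nonneg_right hfinal (Real.exp_pos (t * C)).le
  linear_combination this - ‖B t - toL2 (β t)‖ ^ 2 * hexp

end Estimate

end GFTorus

end

/-! ### The main theorem. -/

theorem theorem1 (d m : ℕ) :
    (∀ a ∈ Sol d, ∀ b : UnitAddTorus (Fin d) → Vec d, IsSmooth b → toL2 b ∈ Sol d →
      relEntropy m a b = (K m (a - toL2 b) : EReal)) ∧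
    ∀ L : ℝ≥0, ∃ C : ℝ, 0 ≤ C ∧
      ∀ T : ℝ, 0 < T →
      ∀ (φ : ℝ → L2Scalar d) (B v : ℝ → L2Field d), IsDissipativeSolution m T φ B v →
      ∀ (ψ : ℝ → UnitAddTorus (Fin d) → ℝ) (β ω : ℝ → UnitAddTorus (Fin d) → Vec d),
        IsSmoothOn T ψ → IsSmoothOn T ω →
        (∀ t ∈ Icc 0 T, β t = grad (ψ t)) →
        (∀ t ∈ Icc 0 T, toL2 (ω t) ∈ Sol d) →
        (∀ t ∈ Icc 0 T, SpaceLipschitz L (β t) ∧ SpaceLipschitz L (ω t)) →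
        (∀ᵐ s ∂(volume.restrict (Icc 0 T)), relEntropy m (v s) (ω s) ≠ ⊤) ∧
        IntegrableOn (fun s => (relEntropy m (v s) (ω s)).toReal) (Icc 0 T) ∧
        IntegrableOn (linTerm m T B v β ω) (Icc 0 T) ∧
        (∀ t ∈ Icc 0 T,
          ‖B t - toL2 (β t)‖ ^ 2 +
              ∫ s in (0 : ℝ)..t, Real.exp ((t - s) * C) *
                ((relEntropy m (v s) (ω s)).toReal - 2 * linTerm m T B v β ω s) ≤
            ‖B 0 - toL2 (β 0)‖ ^ 2 * Real.exp (t * C)) ∧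
        (SolvesGF m T β ω →
          (∀ t ∈ Icc 0 T, linTerm m T B v β ω t = 0) ∧
          (∀ t ∈ Icc 0 T,
            ‖B t - toL2 (β t)‖ ^ 2 +
                ∫ s in (0 : ℝ)..t, Real.exp ((t - s) * C) *
                  (relEntropy m (v s) (ω s)).toReal ≤
              ‖B 0 - toL2 (β 0)‖ ^ 2 * Real.exp (t * C)) ∧
          (B 0 = toL2 (β 0) →
            (∀ t ∈ Icc 0 T, B t = toL2 (β t)) ∧
            ∀ᵐ t ∂(volume.restrict (Icc 0 T)), v t = toL2 (ω t))) := by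
  refine ⟨fun a _ b hb _ => relEntropy_eq a hb, fun L =>
    ⟨2 * L + 2 * (d * L) ^ 2, by positivity, ?_⟩⟩
  intro T hT φ B v h ψ β ω hψ hω hβψ hsol hL
  have hβ : IsSmoothOn T β := (hψ.grad hT).congr hβψ
  obtain ⟨hfin, hηi, hineq⟩ := h.relative_entropy_inequality hT hψ hω hβψ hsol hL
  refine ⟨?_, hηi, h.integrableOn_linTerm hT hβ hω hsol, hineq, fun hGF => ?_⟩
  · filter_upwards [hfin, ae_restrict_mem measurableSet_Icc] with s hs hsT
    rw [relEntropy_eq _ (hω.isSmooth hsT)]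
    simpa using hs
  have hlin : ∀ t ∈ Icc 0 T, linTerm m T B v β ω t = 0 := by
    intro t ht
    have h1 : (fun x => grad (fun y => (inner ℝ (ω t y) (β t y) : ℝ)) x + tderiv T β t x) =
        fun _ => 0 := by
      funext x
      rw [add_comm]
      exact hGF.1 t ht x
    rw [linTerm, h1, toL2_zero, hGF.2 t ht, add_neg_cancel]
    simp
  have hineq' : ∀ t ∈ Icc 0 T,
      ‖B t - toL2 (β t)‖ ^ 2 + ∫ s in (0 : ℝ)..t,
        Real.exp ((t - s) * (2 * L + 2 * (d * L) ^ 2)) * (relEntropy m (v s) (ω s)).toReal ≤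
      ‖B 0 - toL2 (β 0)‖ ^ 2 * Real.exp (t * (2 * L + 2 * (d * L) ^ 2)) := by
    intro t ht
    have e : ∫ s in (0 : ℝ)..t, Real.exp ((t - s) * (2 * L + 2 * (d * L) ^ 2)) *
        ((relEntropy m (v s) (ω s)).toReal - 2 * linTerm m T B v β ω s) =
        ∫ s in (0 : ℝ)..t, Real.exp ((t - s) * (2 * L + 2 * (d * L) ^ 2)) *
          (relEntropy m (v s) (ω s)).toReal := by
      refine intervalIntegral.integral_congr fun s hs => ?_
      rw [uIcc_of_le ht.1] at hs
      simp only [hlin s ⟨hs.1, hs.2.trans ht.2⟩, mul_zero, sub_zero]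
    rw [← e]
    exact hineq t ht
  refine ⟨hlin, hineq', fun h0 => ?_⟩
  set f : ℝ → ℝ → ℝ := fun t s =>
    Real.exp ((t - s) * (2 * L + 2 * (d * L) ^ 2)) * (relEntropy m (v s) (ω s)).toReal
  -- With equal initial data the right-hand side is zero, so both nonnegative terms on the left
  -- vanish.
  have hf0 : ∀ t, 0 ≤ᵐ[volume.restrict (Icc 0 T)] f t := by
    intro t
    filter_upwards [ae_restrict_mem measurableSet_Icc] with s hs
    simp only [f, toReal_relEntropy _ (hω.isSmooth hs)]
    exact mul_nonneg (Real.exp_pos _).le ENNReal.toReal_nonneg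
  have hle : ∀ t ∈ Icc 0 T, ‖B t - toL2 (β t)‖ ^ 2 + ∫ s in Icc 0 t, f t s ≤ 0 := by
    intro t ht
    have := hineq' t ht
    rw [h0, sub_self, intervalIntegral.integral_of_le ht.1, ← integral_Icc_eq_integral_Ioc] at this
    simpa using this
  have hnn : ∀ t ∈ Icc 0 T, 0 ≤ ∫ s in Icc 0 t, f t s := fun t ht =>
    integral_nonneg_of_ae (ae_restrict_of_ae_restrict_of_subset (Icc_subset_Icc_right ht.2) (hf0 t))
  constructor
  · intro t ht
    have h1 : ‖B t - toL2 (β t)‖ ^ 2 ≤ 0 := by linarith [hle t ht, hnn t ht]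
    exact sub_eq_zero.1 (norm_eq_zero.1 (pow_eq_zero_iff two_ne_zero |>.1
      (le_antisymm h1 (sq_nonneg _))))
  · have hTm : T ∈ Icc 0 T := ⟨hT.le, le_rfl⟩
    -- At the final time the vanishing integral of a nonnegative function gives zero relative
    -- entropy almost everywhere on `[0,T]`, and the Poincaré bound then gives equality of the
    -- velocities.
    have h1 : ∫ s in Icc 0 T, f T s = 0 :=
      le_antisymm (by linarith [hle T hTm, sq_nonneg ‖B T - toL2 (β T)‖]) (hnn T hTm)
    have hfi : IntegrableOn (f T) (Icc 0 T) :=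
      IntegrableOn.continuousOn_mul (by fun_prop) hηi isCompact_Icc
    rw [integral_eq_zero_iff_of_nonneg_ae (hf0 T) hfi] at h1
    filter_upwards [h1, hfin, h.mem_sol, ae_restrict_mem measurableSet_Icc] with s hs hK hvs hsT
    have h2 : (K m (v s - toL2 (ω s))).toReal = 0 := by
      rw [← toReal_relEntropy _ (hω.isSmooth hsT)]
      exact (mul_eq_zero.1 hs).resolve_left (Real.exp_pos _).ne'
    have h3 := norm_sq_le_two_mul_K ((Sol d).sub_mem hvs (hsol s hsT)) hK
    rw [h2, mul_zero] at h3
    exact sub_eq_zero.1 (norm_eq_zero.1 (pow_eq_zero_iff two_ne_zero |>.1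
      (le_antisymm h3 (sq_nonneg _))))
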